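/- Let $d\ge 2$ and let $\mathcal K\subset\mathbb R^d$ be an origin-symmetric convex body (compact, convex, with non-empty interior), with norm $\|x\|_{\mathcal K}=\inf\{\lambda>0:\lambda^{-1}x\in\mathcal K\}$. Let $\mathfrak C$ be the class of subsets of $\mathbb R^d$ which are the closure of an open set with compact $\mathcal C^2$ boundary. Write $E_n\to E$ in $\mathfrak C$ if there are $\mathcal C^2$ diffeomorphisms $\Phi_n$ of $\mathbb R^d$ with $E_n=\Phi_n(E)$ such that $\Phi_n$ and its derivatives of order one and two converge locally uniformly to those of the identity. Let $\mathcal H^{s}$ be the Hausdorff measure, normalised so that $\mathcal H^k$ is Lebesgue measure on $\mathbb R^k$, let $\kappa_{d-2}=\mathcal H^{d-2}(\mathbb S^{d-2})$ be the measure of the unit sphere of $\mathbb R^{d-1}$, and let $\widetilde\chi_E=\chi_{E^c}-\chi_E$. For $E\in\mathfrak C$, $x\in\partial E$ and $\alpha\in(0,1)$ the anisotropic fractional curvature is $$H^{\mathcal K}_\alpha(x,E)=\frac1{\kappa_{d-2}}\lim_{r\downarrow0}\int_{B_r(x)^c}\frac{\widetilde\chi_E(y)}{\|x-y\|_{\mathcal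 K}^{d+\alpha}}\,dy .$$ Let $\nu(x)$ be the outer unit normal to $\partial E$ at $x$, and for a unit vector $e\perp\nu(x)$ let $K_e(x,E)=-D^2f(0)e\cdot e$ be the directional curvature, where $f$ is the $\mathcal C^2$ function, defined near $0$ on $\nu(x)^\perp$, with $f(0)=0$, $\nabla f(0)=0$, such that near $x$ the set $E$ is $\{x+v+h\,\nu(x): v\in\nu(x)^\perp,\ h\le f(v)\}$. **Theorem.** Let $\alpha_n\in(0,1)$ with $\alpha_n\to1$, and let $E,E_n\in\mathfrak C$ be such that $E_n\to E$ in $\mathfrak C$. Let $x\in\partial E$ with $x\in\partial E_n$ for every $n$. Then for every $n$ the integrals in the definition of $H^{\mathcal K}_{\alpha_n}(x,E_n)$ converge absolutely for each $r>0$, the limit as $r\downarrow0$ exists and is finite, and $$\lim_{n\to\infty}(1-\alpha_n)\,H^{\mathcal K}_{\alpha_n}(x,E_n)=\frac1{\kappa_{d-2}}\int_{\{e\in\mathbb R^d:\ |e|=1,\ e\perp\nu(x)\}}\frac{K_e(x,E)}{\|e\|_{\mathcal K}^{d+1}}\,\mathcal H^{d-2}(de).$$ -/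

import Mathlib

open Set Filter Topology MeasureTheory
open scoped Manifold RealInnerProductSpace

noncomputable section

namespace AnisotropicCurvature

variable {d : ℕ}

/-- The orthogonal projection of `ℝᵈ` onto the hyperplane `ν^⊥`. -/
def tangentProj (ν : EuclideanSpace ℝ (Fin d)) : EuclideanSpace ℝ (Fin d) →L[ℝ] (ℝ ∙ ν)ᗮ :=
  (ℝ ∙ ν)ᗮ.orthogonalProjectionOnto

/-- Normal coordinates of `E` at `p`: `ν` is a unit vector, `f` is a function on the hyperplane
`ν^⊥` which is of class `C²` near `0` and satisfies `f 0 = 0` and `∇f 0 = 0`, and near `p` the set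
`E` is the closed subgraph of `f` over the tangent hyperplane `p + ν^⊥`, with `ν` pointing out of
`E`. (`ContDiffAt ℝ 2` at `0` means: of class `C²` in a neighbourhood of `0`.) -/
structure IsNormalGraph (E : Set (EuclideanSpace ℝ (Fin d))) (p ν : EuclideanSpace ℝ (Fin d))
    (f : (ℝ ∙ ν)ᗮ → ℝ) : Prop where
  norm_normal : ‖ν‖ = 1
  contDiffAt : ContDiffAt ℝ 2 f 0
  map_zero : f 0 = 0
  fderiv_zero : fderiv ℝ f 0 = 0
  eventually_mem_iff : ∀ᶠ y in 𝓝 p, (y ∈ E ↔ ⟪ν, y - p⟫ ≤ f (tangentProj ν (y - p)))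

/-- The class `𝔠`: closures of open sets, with compact boundary of class `C²`. -/
structure MemC2Class (E : Set (EuclideanSpace ℝ (Fin d))) : Prop where
  exists_isOpen : ∃ U : Set (EuclideanSpace ℝ (Fin d)), IsOpen U ∧ closure U = E
  isCompact_frontier : IsCompact (frontier E)
  exists_isNormalGraph : ∀ p ∈ frontier E, ∃ ν f, IsNormalGraph E p ν f

/-- Convergence `Eₙ → E` in `𝔠`: there are `C²` diffeomorphisms `Φₙ` of `ℝᵈ` with `Eₙ = Φₙ(E)`
which converge to the identity in `C²` (locally uniformly, with the derivatives of order
at most two). -/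
def ConvergesInC2 (En : ℕ → Set (EuclideanSpace ℝ (Fin d)))
    (E : Set (EuclideanSpace ℝ (Fin d))) : Prop :=
  ∃ Φ : ℕ → Diffeomorph 𝓘(ℝ, EuclideanSpace ℝ (Fin d)) 𝓘(ℝ, EuclideanSpace ℝ (Fin d))
      (EuclideanSpace ℝ (Fin d)) (EuclideanSpace ℝ (Fin d)) 2,
    (∀ n, En n = Φ n '' E) ∧
    ∀ k ≤ 2, TendstoLocallyUniformly
      (fun n => iteratedFDeriv ℝ k (Φ n : EuclideanSpace ℝ (Fin d) → EuclideanSpace ℝ (Fin d)))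
      (iteratedFDeriv ℝ k (id : EuclideanSpace ℝ (Fin d) → EuclideanSpace ℝ (Fin d))) atTop

open Classical in
/-- The outer unit normal vector `ν(p)` to `∂E` at `p`
(with value `0` where `E` has no normal graph). -/
def outerNormal (E : Set (EuclideanSpace ℝ (Fin d))) (p : EuclideanSpace ℝ (Fin d)) :
    EuclideanSpace ℝ (Fin d) :=
  if h : ∃ ν f, IsNormalGraph E p ν f then h.choose else 0

open Classical in
/-- The directional curvature `K_e(p, E) = - D²f(0) e · e`, where `f` represents `E` in normal
coordinates at `p`, and `e` is a vector of the tangent hyperplane `ν(p)^⊥`. -/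
def directionalCurvature (E : Set (EuclideanSpace ℝ (Fin d))) (p e : EuclideanSpace ℝ (Fin d)) :
    ℝ :=
  if h : ∃ ν f, IsNormalGraph E p ν f then
    - fderiv ℝ (fderiv ℝ h.choose_spec.choose) 0 (tangentProj h.choose e)
        (tangentProj h.choose e)
  else 0

/-- The signed indicator `χ̃_E = χ_{Eᶜ} - χ_E`. -/
def signedIndicator (E : Set (EuclideanSpace ℝ (Fin d))) (y : EuclideanSpace ℝ (Fin d)) : ℝ :=
  Eᶜ.indicator 1 y - E.indicator 1 y

/-- `κ_{d-2} = ℋ^{d-2}(𝕊^{d-2})`, with `𝕊^{d-2}` the unit sphere of `ℝ^{d-1}` (for `d ≥ 2`). -/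
def kappa (d : ℕ) : ℝ :=
  (μHE[d - 2] (Metric.sphere (0 : EuclideanSpace ℝ (Fin (d - 1))) 1)).toReal

/-- The integrand `χ̃_E(y) ‖x - y‖_K^{-(d+α)}`, where `‖·‖_K` is the gauge of `K`. -/
def curvatureIntegrand (K : ConvexBody (EuclideanSpace ℝ (Fin d))) (α : ℝ)
    (x : EuclideanSpace ℝ (Fin d)) (E : Set (EuclideanSpace ℝ (Fin d)))
    (y : EuclideanSpace ℝ (Fin d)) : ℝ :=
  signedIndicator E y / gauge (K : Set (EuclideanSpace ℝ (Fin d))) (x - y) ^ ((d : ℝ) + α)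

/-- The truncated curvature: `κ_{d-2}⁻¹` times the integral over the complement of `B_r(x)`. -/
def truncatedCurvature (K : ConvexBody (EuclideanSpace ℝ (Fin d))) (α : ℝ)
    (x : EuclideanSpace ℝ (Fin d)) (E : Set (EuclideanSpace ℝ (Fin d))) (r : ℝ) : ℝ :=
  1 / kappa d * ∫ y in (Metric.ball x r)ᶜ, curvatureIntegrand K α x E y

/-- The anisotropic fractional curvature `H^K_α(x, E)`: the limit of the truncated curvatures
as `r ↓ 0`. -/
def anisotropicCurvature (K : ConvexBody (EuclideanSpace ℝ (Fin d))) (α : ℝ)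
    (x : EuclideanSpace ℝ (Fin d)) (E : Set (EuclideanSpace ℝ (Fin d))) : ℝ :=
  limUnder (𝓝[>] (0 : ℝ)) (truncatedCurvature K α x E)

/-- The unit vectors tangent to `∂E` at `x`. -/
def tangentSphere (E : Set (EuclideanSpace ℝ (Fin d))) (x : EuclideanSpace ℝ (Fin d)) :
    Set (EuclideanSpace ℝ (Fin d)) :=
  {e | ‖e‖ = 1 ∧ ⟪outerNormal E x, e⟫ = 0}

/-! The normal coordinates at a point are unique, so that `outerNormal` and
`directionalCurvature` do not depend on the choice made in their definitions. -/

theorem tangentProj_add_smul {ν : EuclideanSpace ℝ (Fin d)} (v : (ℝ ∙ ν)ᗮ) (h : ℝ) :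
    tangentProj ν ((v : EuclideanSpace ℝ (Fin d)) + h • ν) = v := by
  have h1 : tangentProj ν ν = 0 := by
    unfold tangentProj
    rw [Submodule.orthogonalProjectionOnto_eq_zero_iff, Submodule.orthogonal_orthogonal]
    exact Submodule.mem_span_singleton_self ν
  have h2 : tangentProj ν (v : EuclideanSpace ℝ (Fin d)) = v := by
    simp [tangentProj]
  rw [map_add, map_smul, h1, h2, smul_zero, add_zero]

theorem inner_add_smul {ν : EuclideanSpace ℝ (Fin d)} (hν : ‖ν‖ = 1) (v : (ℝ ∙ ν)ᗮ) (h : ℝ) :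
    ⟪ν, (v : EuclideanSpace ℝ (Fin d)) + h • ν⟫ = h := by
  have h1 : ⟪ν, (v : EuclideanSpace ℝ (Fin d))⟫ = 0 :=
    (Submodule.mem_orthogonal_singleton_iff_inner_right).1 v.2
  rw [inner_add_right, h1, inner_smul_right, real_inner_self_eq_norm_sq, hν]
  simp

theorem IsNormalGraph.eventually_sign {E : Set (EuclideanSpace ℝ (Fin d))}
    {p ν : EuclideanSpace ℝ (Fin d)} {f : (ℝ ∙ ν)ᗮ → ℝ} (h : IsNormalGraph E p ν f)
    (w : EuclideanSpace ℝ (Fin d)) :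
    (⟪ν, w⟫ < 0 → ∀ᶠ t in 𝓝[>] (0 : ℝ), p + t • w ∈ E) ∧
    (0 < ⟪ν, w⟫ → ∀ᶠ t in 𝓝[>] (0 : ℝ), p + t • w ∉ E) := by
  have hdiff : HasFDerivAt f (0 : (ℝ ∙ ν)ᗮ →L[ℝ] ℝ) 0 := by
    rw [← h.fderiv_zero]
    exact (h.contDiffAt.differentiableAt (by norm_num)).hasFDerivAt
  have hg : HasDerivAt (fun t : ℝ => f (t • tangentProj ν w)) 0 0 := by
    have h2 : HasDerivAt (fun t : ℝ => t • tangentProj ν w) (tangentProj ν w) 0 := by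
      simpa using (hasDerivAt_id (0 : ℝ)).smul_const (tangentProj ν w)
    have h3 : HasFDerivAt f (0 : (ℝ ∙ ν)ᗮ →L[ℝ] ℝ) ((0 : ℝ) • tangentProj ν w) := by
      simpa using hdiff
    have h4 := h3.comp_hasDerivAt (0 : ℝ) h2
    rw [zero_apply] at h4
    exact h4
  have hslope := (hasDerivAt_iff_tendsto_slope.1 hg).mono_left
    (nhdsWithin_mono (0 : ℝ) (fun t (ht : 0 < t) => ht.ne'))
  have hmem : ∀ᶠ t in 𝓝[>] (0 : ℝ), (p + t • w ∈ E ↔ t * ⟪ν, w⟫ ≤ f (t • tangentProj ν w)) := by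
    have hc : Tendsto (fun t : ℝ => p + t • w) (𝓝[>] 0) (𝓝 p) := by
      have : Continuous (fun t : ℝ => p + t • w) := by fun_prop
      simpa using (this.tendsto 0).mono_left nhdsWithin_le_nhds
    filter_upwards [hc.eventually h.eventually_mem_iff] with t ht
    simpa [inner_smul_right] using ht
  have hpos : ∀ᶠ t in 𝓝[>] (0 : ℝ), 0 < t := self_mem_nhdsWithin
  have key : ∀ t : ℝ, 0 < t → f (t • tangentProj ν w) =
      t * slope (fun t : ℝ => f (t • tangentProj ν w)) 0 t := by
    intro t ht
    rw [slope_def_field]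
    simp only [zero_smul, h.map_zero, sub_zero]
    field_simp
  constructor
  · intro hw
    filter_upwards [hmem, hpos, hslope.eventually (lt_mem_nhds hw)] with t h1 h2 h3
    rw [h1, key t h2]
    exact (mul_lt_mul_of_pos_left h3 h2).le
  · intro hw
    filter_upwards [hmem, hpos, hslope.eventually (gt_mem_nhds hw)] with t h1 h2 h3
    rw [h1, key t h2, not_le]
    exact mul_lt_mul_of_pos_left h3 h2

theorem IsNormalGraph.normal_unique {E : Set (EuclideanSpace ℝ (Fin d))}
    {p ν μ : EuclideanSpace ℝ (Fin d)} {f : (ℝ ∙ ν)ᗮ → ℝ} {g : (ℝ ∙ μ)ᗮ → ℝ}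
    (hf : IsNormalGraph E p ν f) (hg : IsNormalGraph E p μ g) : ν = μ := by
  by_contra hne
  have hlt : ⟪ν, μ⟫ < 1 := (inner_lt_one_iff_real_of_norm_eq_one hf.norm_normal hg.norm_normal).2 hne
  have h1 : ⟪ν, μ - ν⟫ < 0 := by
    rw [inner_sub_right, real_inner_self_eq_norm_sq, hf.norm_normal]; linarith
  have h2 : 0 < ⟪μ, μ - ν⟫ := by
    rw [inner_sub_right, real_inner_self_eq_norm_sq, hg.norm_normal, real_inner_comm]; linarith
  obtain ⟨t, ht1, ht2⟩ :=
    (((hf.eventually_sign (μ - ν)).1 h1).and ((hg.eventually_sign (μ - ν)).2 h2)).exists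
  exact ht2 ht1

theorem IsNormalGraph.eventuallyEq {E : Set (EuclideanSpace ℝ (Fin d))}
    {p ν : EuclideanSpace ℝ (Fin d)} {f g : (ℝ ∙ ν)ᗮ → ℝ}
    (hf : IsNormalGraph E p ν f) (hg : IsNormalGraph E p ν g) : f =ᶠ[𝓝 0] g := by
  have aux : ∀ {u v : (ℝ ∙ ν)ᗮ → ℝ}, IsNormalGraph E p ν u → IsNormalGraph E p ν v →
      ∀ᶠ a in 𝓝 (0 : (ℝ ∙ ν)ᗮ), u a ≤ v a := by
    intro u v hu hv
    have hc : Tendsto (fun a : (ℝ ∙ ν)ᗮ => p + ((a : EuclideanSpace ℝ (Fin d)) + u a • ν))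
        (𝓝 0) (𝓝 p) := by
      have h0 : ContinuousAt (fun a : (ℝ ∙ ν)ᗮ => p + ((a : EuclideanSpace ℝ (Fin d)) + u a • ν))
          0 := by
        have := hu.contDiffAt.continuousAt
        fun_prop
      simpa [ContinuousAt, hu.map_zero] using h0
    filter_upwards [hc.eventually hu.eventually_mem_iff, hc.eventually hv.eventually_mem_iff]
      with a h1 h2
    rw [add_sub_cancel_left, inner_add_smul hu.norm_normal, tangentProj_add_smul] at h1 h2
    exact h2.1 (h1.2 le_rfl)
  filter_upwards [aux hf hg, aux hg hf] with a h1 h2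
  exact le_antisymm h1 h2

theorem IsNormalGraph.outerNormal_eq {E : Set (EuclideanSpace ℝ (Fin d))}
    {p ν : EuclideanSpace ℝ (Fin d)} {f : (ℝ ∙ ν)ᗮ → ℝ} (hf : IsNormalGraph E p ν f) :
    outerNormal E p = ν := by
  have h : ∃ ν f, IsNormalGraph E p ν f := ⟨ν, f, hf⟩
  rw [outerNormal, dif_pos h]
  exact h.choose_spec.choose_spec.normal_unique hf

theorem IsNormalGraph.directionalCurvature_eq {E : Set (EuclideanSpace ℝ (Fin d))}
    {p ν : EuclideanSpace ℝ (Fin d)} {f : (ℝ ∙ ν)ᗮ → ℝ} (hf : IsNormalGraph E p ν f)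
    (e : EuclideanSpace ℝ (Fin d)) :
    directionalCurvature E p e =
      - fderiv ℝ (fderiv ℝ f) 0 (tangentProj ν e) (tangentProj ν e) := by
  have h : ∃ ν f, IsNormalGraph E p ν f := ⟨ν, f, hf⟩
  have key : ∀ (μ : EuclideanSpace ℝ (Fin d)) (g : (ℝ ∙ μ)ᗮ → ℝ), IsNormalGraph E p μ g →
      fderiv ℝ (fderiv ℝ g) 0 (tangentProj μ e) (tangentProj μ e) =
        fderiv ℝ (fderiv ℝ f) 0 (tangentProj ν e) (tangentProj ν e) := by
    intro μ g hg
    obtain rfl := hg.normal_unique hf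
    rw [(hg.eventuallyEq hf).fderiv.fderiv_eq]
  rw [directionalCurvature, dif_pos h, key _ _ h.choose_spec.choose_spec]

end AnisotropicCurvature

end

open AnisotropicCurvature

noncomputable section

namespace AnisotropicCurvature

set_option linter.unusedSectionVars false

open Module Metric
open scoped Pointwise ENNReal NNReal

section SphereMeasure

/-- A comparison of measures that holds near every point holds globally. -/
theorem measure_le_of_forall_nhds {X : Type*} [TopologicalSpace X] [SecondCountableTopology X]
    [MeasurableSpace X] [OpensMeasurableSpace X] {μ ν : Measure X}
    (h : ∀ x, ∃ U ∈ 𝓝 x, ∀ A ⊆ U, MeasurableSet A → μ A ≤ ν A) : μ ≤ ν := by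
  choose U hU hle using h
  obtain ⟨s, hs, hcov⟩ := TopologicalSpace.countable_cover_nhds (fun x => interior_mem_nhds.2 (hU x))
  rcases s.eq_empty_or_nonempty with rfl | hne
  · have : IsEmpty X := by
      rw [← Set.univ_eq_empty_iff, ← hcov]; simp
    rw [Measure.eq_zero_of_isEmpty μ]
    exact Measure.zero_le _
  obtain ⟨e, rfl⟩ := hs.exists_eq_range hne
  refine Measure.le_iff.2 fun A hA => ?_
  set V : ℕ → Set X := fun k => interior (U (e k))
  have hV : ⋃ k, V k = univ := by simpa [V] using hcov
  have hmeas : ∀ k, MeasurableSet (A ∩ disjointed V k) := fun k =>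
    hA.inter (MeasurableSet.disjointed (fun i => isOpen_interior.measurableSet) k)
  have hdisj : Pairwise (Function.onFun Disjoint fun k => A ∩ disjointed V k) := fun i j hij =>
    (disjoint_disjointed V hij).mono inter_subset_right inter_subset_right
  have hAeq : A = ⋃ k, A ∩ disjointed V k := by
    rw [← inter_iUnion, iUnion_disjointed, hV, inter_univ]
  rw [hAeq, measure_iUnion hdisj hmeas, measure_iUnion hdisj hmeas]
  refine ENNReal.tsum_le_tsum fun k => hle (e k) _ ?_ (hmeas k)
  exact (inter_subset_right.trans (disjointed_subset V k)).trans interior_subset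

section Hausdorff

variable {X Y : Type*} [MetricSpace X] [MeasurableSpace X] [BorelSpace X]
  [MetricSpace Y] [MeasurableSpace Y] [BorelSpace Y]

theorem euclideanHausdorffMeasure_image_le {K : ℝ≥0} {f : X → Y} {s : Set X}
    (hf : LipschitzOnWith K f s) (m : ℕ) : μHE[m] (f '' s) ≤ (K : ℝ≥0∞) ^ m * μHE[m] s := by
  simp_rw [Measure.euclideanHausdorffMeasure_def, Measure.smul_apply, ENNReal.smul_def, smul_eq_mul]
  have := hf.hausdorffMeasure_image_le (Nat.cast_nonneg (α := ℝ) m)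
  rw [ENNReal.rpow_natCast] at this
  rw [mul_left_comm]
  gcongr

theorem le_euclideanHausdorffMeasure_image {K : ℝ≥0} {f : X → Y} {s : Set X}
    (hf : ∀ a ∈ s, ∀ b ∈ s, dist a b ≤ K * dist (f a) (f b)) (m : ℕ) :
    μHE[m] s ≤ (K : ℝ≥0∞) ^ m * μHE[m] (f '' s) := by
  rcases s.eq_empty_or_nonempty with rfl | ⟨x, hx⟩
  · simp
  have : Nonempty X := ⟨x⟩
  have hinj : InjOn f s := fun a ha b hb hab => by
    have := hf a ha b hb
    rw [hab, dist_self, mul_zero] at this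
    exact dist_le_zero.1 this
  have hg : LipschitzOnWith K (Function.invFunOn f s) (f '' s) := by
    refine LipschitzOnWith.of_dist_le_mul ?_
    rintro _ ⟨a, ha, rfl⟩ _ ⟨b, hb, rfl⟩
    rw [hinj.leftInvOn_invFunOn ha, hinj.leftInvOn_invFunOn hb]
    exact hf a ha b hb
  have := euclideanHausdorffMeasure_image_le hg m
  rwa [hinj.leftInvOn_invFunOn.image_image] at this

end Hausdorff

/-- A chart which flattens the unit sphere near its point `p`. -/
def flatteningMap {F : Type*} [NormedAddCommGroup F] [InnerProductSpace ℝ F] (p y : F) : F := ⟪p, y⟫⁻¹ • y - p + ‖y‖ • p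

theorem hasStrictFDerivAt_flatteningMap {F : Type*} [NormedAddCommGroup F]
    [InnerProductSpace ℝ F] (p : F) (hp : ‖p‖ = 1) :
    HasStrictFDerivAt (flatteningMap p) (ContinuousLinearMap.id ℝ F) p := by
  have hp0 : p ≠ 0 := by rintro rfl; simp at hp
  have hpp : ⟪p, p⟫ = 1 := by rw [real_inner_self_eq_norm_sq, hp]; norm_num
  have h1 : HasStrictFDerivAt (fun y : F => ⟪p, y⟫) (innerSL ℝ p) p :=
    (innerSL ℝ p).hasStrictFDerivAt
  have h2 : HasStrictFDerivAt (fun y : F => ‖y‖) (innerSL ℝ p) p := by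
    have h3 := (hasStrictFDerivAt_norm_sq p).sqrt (by simp [hp])
    have h4 : (fun y : F => √(‖y‖ ^ 2)) = fun y => ‖y‖ := by
      ext y; exact Real.sqrt_sq (norm_nonneg y)
    rw [h4] at h3
    convert h3 using 1
    ext y
    simp [hp]
  have h3 : HasStrictFDerivAt (fun y : F => ⟪p, y⟫⁻¹) (-innerSL ℝ p) p := by
    have h4 := (hasStrictDerivAt_inv (x := ⟪p, p⟫) (by rw [hpp]; exact one_ne_zero))
      |>.comp_hasStrictFDerivAt p h1
    simpa [hp, Function.comp_def] using h4
  have h5 := ((h3.smul (hasStrictFDerivAt_id p)).sub_const p).add (h2.smul_const p)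
  have h6 : ContinuousLinearMap.id ℝ F = ⟪p, p⟫⁻¹ • ContinuousLinearMap.id ℝ F +
      (-innerSL ℝ p).smulRight (id p) + (innerSL ℝ p).smulRight p := by
    ext y
    simp [hp]
  rw [h6]
  exact h5

theorem finrank_orthogonal_unit {F : Type*} [NormedAddCommGroup F] [InnerProductSpace ℝ F]
    [FiniteDimensional ℝ F] (p : F) (hp : ‖p‖ = 1) :
    finrank ℝ (ℝ ∙ p)ᗮ = finrank ℝ F - 1 := by
  have h := (ℝ ∙ p).finrank_add_finrank_orthogonal
  have hp0 : p ≠ 0 := by rintro rfl; simp at hp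
  rw [finrank_span_singleton hp0] at h
  omega

theorem exists_nhds_flatteningMap {F : Type*} [NormedAddCommGroup F] [InnerProductSpace ℝ F]
    (p : F) (hp : ‖p‖ = 1) {K : ℝ≥0} (hK : 1 < K) :
    ∃ U ∈ 𝓝 p, LipschitzOnWith K (flatteningMap p) U ∧
      ∀ a ∈ U, ∀ b ∈ U, dist a b ≤ K * dist (flatteningMap p a) (flatteningMap p b) := by
  have hK0 : (0 : ℝ) < K := lt_trans one_pos (by exact_mod_cast hK)
  have hK1 : (K : ℝ)⁻¹ < 1 := inv_lt_one_of_one_lt₀ (by exact_mod_cast hK)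
  obtain ⟨U, hU, happ⟩ := (hasStrictFDerivAt_flatteningMap p hp).approximates_deriv_on_nhds
    (c := Real.toNNReal (1 - (K : ℝ)⁻¹)) (Or.inr (Real.toNNReal_pos.2 (by linarith)))
  have key : ∀ a ∈ U, ∀ b ∈ U, ‖flatteningMap p a - flatteningMap p b - (a - b)‖ ≤
      (1 - (K : ℝ)⁻¹) * ‖a - b‖ := fun a ha b hb => by
    simpa [Real.coe_toNNReal _ (by linarith : (0 : ℝ) ≤ 1 - (K : ℝ)⁻¹)] using happ a ha b hb
  refine ⟨U, hU, LipschitzOnWith.of_dist_le_mul fun a ha b hb => ?_, fun a ha b hb => ?_⟩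
  · rw [dist_eq_norm, dist_eq_norm]
    have h1 := norm_add_le (flatteningMap p a - flatteningMap p b - (a - b)) (a - b)
    rw [sub_add_cancel] at h1
    have h2 : 2 - (K : ℝ)⁻¹ ≤ K := by
      have : (K : ℝ) * (K : ℝ)⁻¹ = 1 := mul_inv_cancel₀ hK0.ne'
      nlinarith [sq_nonneg ((K : ℝ) - 1), inv_pos.2 hK0]
    nlinarith [key a ha b hb, norm_nonneg (a - b)]
  · rw [dist_eq_norm, dist_eq_norm]
    have h1 := norm_sub_le (flatteningMap p a - flatteningMap p b)
      (flatteningMap p a - flatteningMap p b - (a - b))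
    rw [sub_sub_cancel] at h1
    have h2 : (K : ℝ)⁻¹ * ‖a - b‖ ≤ ‖flatteningMap p a - flatteningMap p b‖ := by
      nlinarith [key a ha b hb]
    rwa [inv_mul_le_iff₀ hK0] at h2

variable {F : Type*} [NormedAddCommGroup F] [InnerProductSpace ℝ F] [FiniteDimensional ℝ F]
  [MeasurableSpace F] [BorelSpace F]

/-- The coordinates `(v, h)` of `v + h p`, where `v ⊥ p`. -/
def normalCoordinates (p : F) (hp : ‖p‖ = 1) : F ≃ᵐ (ℝ ∙ p)ᗮ × ℝ :=
  ((ℝ ∙ p).measurableEquivProd (0 : F)).trans <| MeasurableEquiv.prodComm.trans <|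
    MeasurableEquiv.prodCongr (MeasurableEquiv.refl _)
      (LinearIsometryEquiv.toSpanUnitSingleton p hp).symm.toMeasurableEquiv

theorem normalCoordinates_symm_apply (p : F) (hp : ‖p‖ = 1) (q : (ℝ ∙ p)ᗮ × ℝ) :
    (normalCoordinates p hp).symm q = q.1 + q.2 • p := by
  have : (normalCoordinates p hp).symm q = ((ℝ ∙ p).measurableEquivProd (0 : F)).symm
    (LinearIsometryEquiv.toSpanUnitSingleton p hp q.2, q.1) := rfl
  rw [this, Submodule.measurableEquivProd_symm_apply]
  simp [add_comm]

theorem measurePreserving_normalCoordinates (p : F) (hp : ‖p‖ = 1) :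
    MeasurePreserving (normalCoordinates p hp) := by
  have h1 := (ℝ ∙ p).measurePreserving_measurableEquivProd (0 : F)
  rw [InnerProductSpace.euclideanHausdorffMeasure_eq_volume] at h1
  refine h1.trans (MeasurePreserving.trans Measure.measurePreserving_swap ?_)
  exact (MeasurePreserving.id _).prod
    (LinearIsometryEquiv.toSpanUnitSingleton p hp).symm.measurePreserving

theorem volume_slab (p : F) (hp : ‖p‖ = 1) {V : Set F} (hV : ∀ y ∈ V, ⟪p, y⟫ = 1) (δ : ℝ) :
    volume (image2 (fun y t => y + t • p) V (Ioo 0 δ)) =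
      ENNReal.ofReal δ * μHE[finrank ℝ F - 1] V := by
  set W : Set (ℝ ∙ p)ᗮ := {w | p + (w : F) ∈ V}
  have himg : image2 (fun y t => y + t • p) V (Ioo 0 δ) =
      (normalCoordinates p hp).symm '' (W ×ˢ Ioo 1 (1 + δ)) := by
    ext z
    simp only [mem_image2, mem_image, Prod.exists, mem_prod, normalCoordinates_symm_apply]
    constructor
    · rintro ⟨y, hy, t, ht, rfl⟩
      refine ⟨⟨y - p, ?_⟩, 1 + t, ⟨?_, ?_⟩, ?_⟩
      · rw [Submodule.mem_orthogonal_singleton_iff_inner_right, inner_sub_right, hV y hy,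
          real_inner_self_eq_norm_sq, hp]; norm_num
      · simpa [W] using hy
      · exact ⟨by linarith [ht.1], by linarith [ht.2]⟩
      · simp only [add_smul, one_smul]; abel
    · rintro ⟨w, t, ⟨hw, ht⟩, rfl⟩
      refine ⟨p + w, hw, t - 1, ⟨by linarith [ht.1], by linarith [ht.2]⟩, ?_⟩
      simp only [sub_smul, one_smul]; abel
  have hVW : V = (fun w : (ℝ ∙ p)ᗮ => p + (w : F)) '' W := by
    ext y
    constructor
    · intro hy
      refine ⟨⟨y - p, ?_⟩, ?_, ?_⟩
      · rw [Submodule.mem_orthogonal_singleton_iff_inner_right, inner_sub_right, hV y hy,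
          real_inner_self_eq_norm_sq, hp]; norm_num
      · simpa [W] using hy
      · simp
    · rintro ⟨w, hw, rfl⟩
      exact hw
  have hiso : Isometry (fun w : (ℝ ∙ p)ᗮ => p + (w : F)) :=
    Isometry.of_dist_eq fun a b => by simp [Subtype.dist_eq]
  rw [himg, MeasurableEquiv.image_symm,
    (measurePreserving_normalCoordinates p hp).measure_preimage_equiv, Measure.volume_eq_prod,
    Measure.prod_prod, Real.volume_Ioo, add_sub_cancel_left, mul_comm]
  congr 1
  rw [hVW, hiso.euclideanHausdorffMeasure_image, ← finrank_orthogonal_unit p hp,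
    InnerProductSpace.euclideanHausdorffMeasure_eq_volume]

theorem volume_shell [Nontrivial F] {A : Set (sphere (0 : F) 1)} (hA : MeasurableSet A) (δ : ℝ) :
    volume (Ioo (1 : ℝ) (1 + δ) • ((↑) '' A : Set F)) =
      volume.toSphere A * ∫⁻ r in Ioo (1 : ℝ) (1 + δ), ENNReal.ofReal (r ^ (finrank ℝ F - 1)) := by
  set J : Set (Ioi (0 : ℝ)) := Subtype.val ⁻¹' Ioo (1 : ℝ) (1 + δ)
  have hJ : MeasurableSet J := measurable_subtype_coe measurableSet_Ioo
  have hmp := (volume : Measure F).measurePreserving_homeomorphUnitSphereProd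
  have h1 := hmp.measure_preimage (hA.prod hJ).nullMeasurableSet
  rw [comap_subtype_coe_apply (measurableSet_singleton _).compl, Measure.prod_prod] at h1
  have h2 : ((↑) '' ((homeomorphUnitSphereProd F) ⁻¹' (A ×ˢ J)) : Set F) =
      Ioo (1 : ℝ) (1 + δ) • ((↑) '' A : Set F) := by
    have hJ' : (Subtype.val '' J : Set ℝ) = Ioo 1 (1 + δ) := by
      rw [Subtype.image_preimage_coe, inter_eq_right]
      exact fun r hr => lt_trans one_pos hr.1
    rw [← image2_smul, ← hJ', image2_image_left, image2_image_right, image2_swap, ← image_prod,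
      ← Homeomorph.image_symm, image_image]
    rfl
  rw [← h2, h1]
  congr 1
  rw [Measure.volumeIoiPow, withDensity_apply _ hJ,
    setLIntegral_subtype measurableSet_Ioi _ fun a : ℝ => ENNReal.ofReal (a ^ (finrank ℝ F - 1)),
    Subtype.image_preimage_coe, inter_eq_right.2]
  exact fun r hr => lt_trans one_pos hr.1

theorem toSphere_near (p : sphere (0 : F) 1) {K : ℝ≥0} (hK : 1 < K) :
    ∃ U ∈ 𝓝 p, ∀ A ⊆ U, MeasurableSet A →
      volume.toSphere A ≤ (K : ℝ≥0∞) ^ (2 * finrank ℝ F) *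
        μHE[finrank ℝ F - 1] ((↑) '' A : Set F) ∧
      μHE[finrank ℝ F - 1] ((↑) '' A : Set F) ≤
        (K : ℝ≥0∞) ^ (2 * finrank ℝ F) * volume.toSphere A := by
  have hp : ‖(p : F)‖ = 1 := by simp
  have hntF : Nontrivial F := ⟨⟨p, 0, by rintro h; rw [h] at hp; simp at hp⟩⟩
  have hn : 0 < finrank ℝ F := finrank_pos
  set n := finrank ℝ F
  obtain ⟨U, hU, hlip, hanti⟩ := exists_nhds_flatteningMap (p : F) hp hK
  obtain ⟨ε, hε, hεU⟩ := Metric.mem_nhds_iff.1 hU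
  have hpow : ∀ᶠ δ : ℝ in 𝓝[>] (0 : ℝ), (1 + δ) ^ (n - 1) < (K : ℝ) := by
    have hc : Tendsto (fun δ : ℝ => (1 + δ) ^ (n - 1)) (𝓝 0) (𝓝 ((1 + 0) ^ (n - 1))) :=
      (by fun_prop : Continuous fun δ : ℝ => (1 + δ) ^ (n - 1)).tendsto 0
    refine (hc.mono_left nhdsWithin_le_nhds).eventually (gt_mem_nhds ?_)
    simpa using hK
  have hsmall : ∀ᶠ δ : ℝ in 𝓝[>] (0 : ℝ), δ < ε / 2 ∧ δ < 1 :=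
    ((gt_mem_nhds (half_pos hε)).and (gt_mem_nhds one_pos)).filter_mono nhdsWithin_le_nhds
  obtain ⟨δ, ⟨hδK, hδε, hδ1⟩, hδ0⟩ := ((hpow.and hsmall).and self_mem_nhdsWithin).exists
  change 0 < δ at hδ0
  refine ⟨ball p δ, ball_mem_nhds p hδ0, fun A hA hAm => ?_⟩
  set B : Set F := (↑) '' A
  have hB1 : ∀ a ∈ B, ‖a‖ = 1 := by rintro _ ⟨a, -, rfl⟩; simp
  have hBp : ∀ a ∈ B, ‖a - p‖ < δ := by
    rintro _ ⟨a, ha, rfl⟩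
    have := hA ha
    rwa [mem_ball, Subtype.dist_eq, dist_eq_norm] at this
  have hBpos : ∀ a ∈ B, 0 < ⟪(p : F), a⟫ := fun a ha => by
    have h1 : ⟪(p : F), a⟫ = 1 + ⟪(p : F), a - p⟫ := by
      rw [inner_sub_right, real_inner_self_eq_norm_sq, hp]; ring
    have h2 := abs_real_inner_le_norm (p : F) (a - p)
    rw [hp, one_mul] at h2
    have := neg_le_of_abs_le h2
    linarith [hBp a ha]
  set Sh : Set F := Ioo (1 : ℝ) (1 + δ) • B
  have hShU : Sh ⊆ U := by
    rintro _ ⟨r, hr, a, ha, rfl⟩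
    refine hεU ?_
    simp only [mem_ball, dist_eq_norm]
    have h1 : r • a - (p : F) = (r - 1) • a + (a - p) := by rw [sub_smul, one_smul]; abel
    rw [h1]
    refine (norm_add_le _ _).trans_lt ?_
    rw [norm_smul, hB1 a ha, Real.norm_eq_abs, abs_of_pos (by linarith [hr.1])]
    linarith [hr.2, hBp a ha]
  have hBU : B ⊆ U := fun a ha => hεU <| by
    rw [mem_ball, dist_eq_norm]; linarith [hBp a ha]
  have himg : flatteningMap (p : F) '' Sh =
      image2 (fun y t => y + t • (p : F)) (flatteningMap (p : F) '' B) (Ioo 0 δ) := by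
    have key : ∀ a ∈ B, ∀ r : ℝ, 0 < r →
        flatteningMap (p : F) (r • a) = flatteningMap (p : F) a + (r - 1) • (p : F) := by
      intro a ha r hr
      simp only [flatteningMap, inner_smul_right, norm_smul, hB1 a ha, Real.norm_eq_abs,
        abs_of_pos hr, smul_smul, sub_smul]
      rw [mul_inv, mul_right_comm, inv_mul_cancel₀ hr.ne', mul_one, one_mul]
      abel
    ext z
    constructor
    · rintro ⟨_, ⟨r, hr, a, ha, rfl⟩, rfl⟩
      exact ⟨_, mem_image_of_mem _ ha, r - 1, ⟨by linarith [hr.1], by linarith [hr.2]⟩,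
        (key a ha r (by linarith [hr.1])).symm⟩
    · rintro ⟨_, ⟨a, ha, rfl⟩, t, ht, rfl⟩
      refine ⟨(1 + t) • a, ⟨1 + t, ⟨by linarith [ht.1], by linarith [ht.2]⟩, a, ha, rfl⟩, ?_⟩
      rw [key a ha (1 + t) (by linarith [ht.1]), add_sub_cancel_left]
  have hplane : ∀ y ∈ flatteningMap (p : F) '' B, ⟪(p : F), y⟫ = 1 := by
    rintro _ ⟨a, ha, rfl⟩
    simp only [flatteningMap, inner_add_right, inner_sub_right, inner_smul_right, hB1 a ha,
      real_inner_self_eq_norm_sq, hp, inv_mul_cancel₀ (hBpos a ha).ne']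
    norm_num
  have hslab := volume_slab (p : F) hp hplane δ
  rw [← himg] at hslab
  have hshell := volume_shell hAm δ
  set I := ∫⁻ r in Ioo (1 : ℝ) (1 + δ), ENNReal.ofReal (r ^ (n - 1))
  have hI1 : ENNReal.ofReal δ ≤ I := by
    calc ENNReal.ofReal δ = ∫⁻ r in Ioo (1 : ℝ) (1 + δ), 1 := by simp
      _ ≤ I := by
        refine setLIntegral_mono' measurableSet_Ioo fun r hr => ?_
        rw [ENNReal.one_le_ofReal]
        exact one_le_pow₀ hr.1.le
  have hI2 : I ≤ K * ENNReal.ofReal δ := by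
    calc I ≤ ∫⁻ r in Ioo (1 : ℝ) (1 + δ), (K : ℝ≥0∞) := by
          refine setLIntegral_mono' measurableSet_Ioo fun r hr => ?_
          rw [← ENNReal.ofReal_coe_nnreal]
          refine ENNReal.ofReal_le_ofReal ?_
          exact (pow_le_pow_left₀ (by linarith [hr.1]) hr.2.le _).trans hδK.le
      _ = K * ENNReal.ofReal δ := by simp
  have hvol : (μHE[n] : Measure F) = volume :=
    InnerProductSpace.euclideanHausdorffMeasure_eq_volume
  have hδ : ENNReal.ofReal δ ≠ 0 := by simpa using hδ0
  have hδt : ENNReal.ofReal δ ≠ ⊤ := ENNReal.ofReal_ne_top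
  have e1 := euclideanHausdorffMeasure_image_le (hlip.mono hBU) (n - 1)
  have e2 := le_euclideanHausdorffMeasure_image (fun a ha b hb => hanti a (hBU ha) b (hBU hb)) (n - 1)
  have e3 := euclideanHausdorffMeasure_image_le (hlip.mono hShU) n
  have e4 := le_euclideanHausdorffMeasure_image
    (fun a ha b hb => hanti a (hShU ha) b (hShU hb)) n
  rw [hvol, hslab, hshell] at e3 e4
  have hK1 : (1 : ℝ≥0∞) ≤ K := by exact_mod_cast hK.le
  constructor
  · refine (ENNReal.mul_le_mul_iff_left hδ hδt).1 ?_
    calc volume.toSphere A * ENNReal.ofReal δ ≤ volume.toSphere A * I := by gcongr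
      _ ≤ _ := e4
      _ ≤ (K : ℝ≥0∞) ^ n * (ENNReal.ofReal δ * ((K : ℝ≥0∞) ^ (n - 1) * μHE[n - 1] B)) := by gcongr
      _ = (K : ℝ≥0∞) ^ (n + (n - 1)) * μHE[n - 1] B * ENNReal.ofReal δ := by rw [pow_add]; ring
      _ ≤ _ := mul_le_mul_left (mul_le_mul_left (pow_le_pow_right₀ hK1 (by omega)) _) _
  · refine (ENNReal.mul_le_mul_iff_left hδ hδt).1 ?_
    calc μHE[n - 1] B * ENNReal.ofReal δ
        ≤ (K : ℝ≥0∞) ^ (n - 1) * μHE[n - 1] (flatteningMap (p : F) '' B) * ENNReal.ofReal δ := by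
          gcongr
      _ = (K : ℝ≥0∞) ^ (n - 1) * (ENNReal.ofReal δ * μHE[n - 1] (flatteningMap (p : F) '' B)) := by
          ring
      _ ≤ (K : ℝ≥0∞) ^ (n - 1) * ((K : ℝ≥0∞) ^ n * (volume.toSphere A * (K * ENNReal.ofReal δ))) := by
          exact mul_le_mul_right (e3.trans (by gcongr)) _
      _ = (K : ℝ≥0∞) ^ ((n - 1) + n + 1) * volume.toSphere A * ENNReal.ofReal δ := by
          rw [pow_add, pow_add]; ring
      _ ≤ _ := mul_le_mul_left (mul_le_mul_left (pow_le_pow_right₀ hK1 (by omega)) _) _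

theorem le_of_forall_nnreal_pow_mul_le {a b : ℝ≥0∞} (m : ℕ)
    (h : ∀ K : ℝ≥0, 1 < K → a ≤ (K : ℝ≥0∞) ^ m * b) : a ≤ b := by
  have hK : Tendsto (fun K : ℝ≥0 => (K : ℝ≥0∞) ^ m * b) (𝓝[>] 1) (𝓝 (((1 : ℝ≥0) : ℝ≥0∞) ^ m * b)) := by
    refine ENNReal.Tendsto.mul_const ?_ (Or.inl (by simp))
    have : Continuous fun K : ℝ≥0 => (K : ℝ≥0∞) ^ m := by fun_prop
    exact (this.tendsto 1).mono_left nhdsWithin_le_nhds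
  have := ge_of_tendsto hK (by filter_upwards [self_mem_nhdsWithin] with K hK using h K hK)
  simpa using this

/-- The surface measure on the unit sphere of a Euclidean space, defined through polar coordinates,
is the Hausdorff measure. -/
theorem toSphere_eq_comap_euclideanHausdorffMeasure :
    (volume : Measure F).toSphere =
      (μHE[finrank ℝ F - 1] : Measure F).comap ((↑) : sphere (0 : F) 1 → F) := by
  have hs : MeasurableSet (sphere (0 : F) 1) := isClosed_sphere.measurableSet
  refine le_antisymm ?_ ?_
  · refine Measure.le_iff.2 fun A _ => le_of_forall_nnreal_pow_mul_le (2 * finrank ℝ F)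
      fun K hK => ?_
    have : (volume : Measure F).toSphere ≤ ((K : ℝ≥0∞) ^ (2 * finrank ℝ F)) •
        (μHE[finrank ℝ F - 1] : Measure F).comap ((↑) : sphere (0 : F) 1 → F) := by
      refine measure_le_of_forall_nhds fun p => ?_
      obtain ⟨U, hU, h⟩ := toSphere_near p hK
      refine ⟨U, hU, fun A hA hAm => ?_⟩
      rw [Measure.smul_apply, comap_subtype_coe_apply hs]
      exact (h A hA hAm).1
    exact this A
  · refine Measure.le_iff.2 fun A _ => le_of_forall_nnreal_pow_mul_le (2 * finrank ℝ F)
      fun K hK => ?_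
    have : (μHE[finrank ℝ F - 1] : Measure F).comap ((↑) : sphere (0 : F) 1 → F) ≤
        ((K : ℝ≥0∞) ^ (2 * finrank ℝ F)) • (volume : Measure F).toSphere := by
      refine measure_le_of_forall_nhds fun p => ?_
      obtain ⟨U, hU, h⟩ := toSphere_near p hK
      refine ⟨U, hU, fun A hA hAm => ?_⟩
      rw [Measure.smul_apply, comap_subtype_coe_apply hs]
      exact (h A hA hAm).2
    exact this A

end SphereMeasure

section ParabolicCoordinates

theorem lintegral_polar {W : Type*} [NormedAddCommGroup W] [NormedSpace ℝ W]
    [FiniteDimensional ℝ W] [MeasurableSpace W] [BorelSpace W] [Nontrivial W]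
    (μ : Measure W) [μ.IsAddHaarMeasure] {G : W → ℝ≥0∞} (hG : Measurable G) :
    ∫⁻ v, G v ∂μ = ∫⁻ e, (∫⁻ t in Ioi (0 : ℝ),
      ENNReal.ofReal (t ^ (finrank ℝ W - 1)) * G (t • (e : W))) ∂μ.toSphere := by
  have hmp := μ.measurePreserving_homeomorphUnitSphereProd
  have h1 : ∫⁻ v, G v ∂μ = ∫⁻ x : ({0}ᶜ : Set W), G x ∂(μ.comap (↑)) := by
    rw [lintegral_subtype_comap (measurableSet_singleton _).compl, restrict_compl_singleton]
  have h2 : ∫⁻ x : ({0}ᶜ : Set W), G x ∂(μ.comap (↑)) =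
      ∫⁻ q : sphere (0 : W) 1 × Ioi (0 : ℝ), G (q.2.1 • (q.1 : W))
        ∂(μ.toSphere.prod (Measure.volumeIoiPow (finrank ℝ W - 1))) := by
    rw [← hmp.lintegral_comp_emb (Homeomorph.measurableEmbedding _)]
    refine lintegral_congr fun x => ?_
    congr 1
    have := congrArg Subtype.val ((homeomorphUnitSphereProd W).symm_apply_apply x)
    rw [← this]
    rfl
  rw [h1, h2, lintegral_prod _ (by fun_prop)]
  refine lintegral_congr fun e => ?_
  have hm : Measurable fun r : ℝ => ENNReal.ofReal (r ^ (finrank ℝ W - 1)) := by fun_prop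
  rw [Measure.volumeIoiPow, lintegral_withDensity_eq_lintegral_mul _ (by fun_prop) (by fun_prop)]
  exact lintegral_subtype_comap measurableSet_Ioi
    (fun r : ℝ => ENNReal.ofReal (r ^ (finrank ℝ W - 1)) * G (r • (e : W)))

theorem lintegral_comp_rpow_Ioi {p : ℝ} (hp : 0 < p) (φ : ℝ → ℝ≥0∞) :
    ∫⁻ t in Ioi (0 : ℝ), φ t =
      ∫⁻ s in Ioi (0 : ℝ), ENNReal.ofReal (p * s ^ (p - 1)) * φ (s ^ p) := by
  have himg : (fun s : ℝ => s ^ p) '' Ioi 0 = Ioi 0 := by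
    ext t
    constructor
    · rintro ⟨s, hs, rfl⟩
      exact Real.rpow_pos_of_pos hs p
    · intro ht
      refine ⟨t ^ p⁻¹, Real.rpow_pos_of_pos ht _, ?_⟩
      exact Real.rpow_inv_rpow (le_of_lt ht) hp.ne'
  have hinj : InjOn (fun s : ℝ => s ^ p) (Ioi 0) := fun a ha b hb hab =>
    Real.rpow_left_injOn hp.ne' (le_of_lt (mem_Ioi.1 ha)) (le_of_lt (mem_Ioi.1 hb)) hab
  conv_lhs => rw [← himg]
  rw [lintegral_image_eq_lintegral_abs_deriv_mul measurableSet_Ioi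
    (fun s hs => (Real.hasDerivAt_rpow_const (Or.inl (ne_of_gt hs))).hasDerivWithinAt) hinj]
  refine setLIntegral_congr_fun measurableSet_Ioi fun s hs => ?_
  rw [abs_of_pos (mul_pos hp (Real.rpow_pos_of_pos hs _))]

theorem lintegral_eq_mul_lintegral_comp_mul_left {c : ℝ} (hc : 0 < c) (φ : ℝ → ℝ≥0∞) :
    ∫⁻ h, φ h = ENNReal.ofReal c * ∫⁻ η, φ (c * η) := by
  have himg : (fun s : ℝ => c * s) '' univ = univ :=
    image_univ_of_surjective (mul_left_surjective₀ hc.ne')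
  rw [← setLIntegral_univ, ← himg, lintegral_image_eq_lintegral_abs_deriv_mul .univ
    (f' := fun _ => c)
    (fun s _ => by simpa using (hasDerivAt_id s).const_mul c)
    (mul_right_injective₀ hc.ne').injOn, setLIntegral_univ,
    lintegral_const_mul' _ _ ENNReal.ofReal_ne_top, abs_of_pos hc]

variable {V : Type*} [NormedAddCommGroup V] [InnerProductSpace ℝ V] [FiniteDimensional ℝ V]
  [MeasurableSpace V] [BorelSpace V]

/-- Parabolic polar coordinates `(e, s, η) ↦ t e + t² η ν` with `t = s ^ p`. -/
def parabolicMap (ν : V) (p : ℝ) (q : sphere (0 : (ℝ ∙ ν)ᗮ) 1 × ℝ × ℝ) : V :=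
  (q.2.1 ^ p) • ((q.1 : (ℝ ∙ ν)ᗮ) : V) + ((q.2.1 ^ p) ^ 2 * q.2.2) • ν

/-- The Jacobian of `parabolicMap`. -/
def parabolicJacobian (n : ℕ) (p s : ℝ) : ℝ := p * s ^ (p - 1) * (s ^ p) ^ (n + 1)

/-- The reference measure for `parabolicMap`. -/
def parabolicMeasure (ν : V) : Measure (sphere (0 : (ℝ ∙ ν)ᗮ) 1 × ℝ × ℝ) :=
  (volume : Measure (ℝ ∙ ν)ᗮ).toSphere.prod ((volume.restrict (Ioi 0)).prod volume)

instance (ν : V) : SFinite (parabolicMeasure ν) := by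
  unfold parabolicMeasure; infer_instance

theorem measurable_parabolicMap (ν : V) (p : ℝ) : Measurable (parabolicMap ν p) := by
  unfold parabolicMap
  have : Measurable fun q : sphere (0 : (ℝ ∙ ν)ᗮ) 1 × ℝ × ℝ => ((q.1 : (ℝ ∙ ν)ᗮ) : V) :=
    (continuous_subtype_val.comp (continuous_subtype_val.comp continuous_fst)).measurable
  fun_prop

theorem measurable_parabolicJacobian (n : ℕ) (p : ℝ) : Measurable (parabolicJacobian n p) := by
  unfold parabolicJacobian
  fun_prop

theorem lintegral_parabolic (ν : V) (hν : ‖ν‖ = 1) [Nontrivial (ℝ ∙ ν)ᗮ] {p : ℝ} (hp : 0 < p)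
    {g : V → ℝ≥0∞} (hg : Measurable g) :
    ∫⁻ z, g z = ∫⁻ q, ENNReal.ofReal (parabolicJacobian (finrank ℝ (ℝ ∙ ν)ᗮ) p q.2.1) *
      g (parabolicMap ν p q) ∂parabolicMeasure ν := by
  have hn : 0 < finrank ℝ (ℝ ∙ ν)ᗮ := finrank_pos
  set n := finrank ℝ (ℝ ∙ ν)ᗮ
  have hm := measurable_parabolicMap ν p
  have hJ := measurable_parabolicJacobian n p
  have h1 : ∫⁻ z, g z = ∫⁻ v : (ℝ ∙ ν)ᗮ, ∫⁻ h : ℝ, g (v + h • ν) := by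
    rw [← (measurePreserving_normalCoordinates ν hν).symm.lintegral_comp_emb
      (MeasurableEquiv.measurableEmbedding _), Measure.volume_eq_prod,
      lintegral_prod _ (by fun_prop)]
    simp_rw [normalCoordinates_symm_apply]
  have hmeas : Measurable fun v : (ℝ ∙ ν)ᗮ => ∫⁻ h : ℝ, g (v + h • ν) :=
    Measurable.lintegral_prod_right' (f := fun q : (ℝ ∙ ν)ᗮ × ℝ => g (q.1 + q.2 • ν)) (by fun_prop)
  have hmeas2 : Measurable fun q : sphere (0 : (ℝ ∙ ν)ᗮ) 1 × ℝ × ℝ =>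
      ENNReal.ofReal (parabolicJacobian n p q.2.1) * g (parabolicMap ν p q) := by fun_prop
  rw [h1, lintegral_polar volume hmeas, parabolicMeasure, lintegral_prod _ hmeas2.aemeasurable]
  refine lintegral_congr fun e => ?_
  have hmeas3 : Measurable fun q : ℝ × ℝ =>
      ENNReal.ofReal (parabolicJacobian n p q.1) * g (parabolicMap ν p (e, q)) := by fun_prop
  rw [lintegral_comp_rpow_Ioi hp, lintegral_prod _ hmeas3.aemeasurable]
  refine setLIntegral_congr_fun measurableSet_Ioi fun s hs => ?_
  have ht : 0 < s ^ p := Real.rpow_pos_of_pos hs p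
  have hs1 : 0 < s ^ (p - 1) := Real.rpow_pos_of_pos hs _
  simp only
  rw [lintegral_const_mul' _ _ ENNReal.ofReal_ne_top,
    lintegral_eq_mul_lintegral_comp_mul_left (pow_pos ht 2), ← mul_assoc, ← mul_assoc,
    ← ENNReal.ofReal_mul (by positivity), ← ENNReal.ofReal_mul (by positivity)]
  congr 2
  rw [parabolicJacobian, mul_assoc (p * s ^ (p - 1)), ← pow_add]
  congr 2
  omega

theorem map_parabolicMap (ν : V) (hν : ‖ν‖ = 1) [Nontrivial (ℝ ∙ ν)ᗮ] {p : ℝ} (hp : 0 < p) :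
    ((parabolicMeasure ν).withDensity fun q =>
      ENNReal.ofReal (parabolicJacobian (finrank ℝ (ℝ ∙ ν)ᗮ) p q.2.1)).map (parabolicMap ν p) =
      volume := by
  have hm := measurable_parabolicMap ν p
  have hJ := measurable_parabolicJacobian (finrank ℝ (ℝ ∙ ν)ᗮ) p
  refine Measure.ext_of_lintegral _ fun g hg => ?_
  rw [lintegral_map hg hm, lintegral_withDensity_eq_lintegral_mul _ (by fun_prop) (by fun_prop),
    lintegral_parabolic ν hν hp hg]
  rfl

theorem ae_parabolicMeasure_pos (ν : V) : ∀ᵐ q ∂parabolicMeasure ν, 0 < q.2.1 := by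
  have h : MeasurableSet {q : sphere (0 : (ℝ ∙ ν)ᗮ) 1 × ℝ × ℝ | 0 < q.2.1} :=
    measurableSet_lt measurable_const (by fun_prop)
  refine (ae_iff.2 ?_)
  have : {q : sphere (0 : (ℝ ∙ ν)ᗮ) 1 × ℝ × ℝ | ¬ 0 < q.2.1} = univ ×ˢ (Iic 0 ×ˢ univ) := by
    ext q; simp
  rw [this, parabolicMeasure, Measure.prod_prod, Measure.prod_prod,
    Measure.restrict_apply measurableSet_Iic, Iic_inter_Ioi, Ioc_self]
  simp

theorem parabolicJacobian_nonneg {n : ℕ} {p s : ℝ} (hp : 0 < p) (hs : 0 < s) :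
    0 ≤ parabolicJacobian n p s := by
  unfold parabolicJacobian; positivity

theorem integrable_iff_parabolic (ν : V) (hν : ‖ν‖ = 1) [Nontrivial (ℝ ∙ ν)ᗮ] {p : ℝ} (hp : 0 < p)
    {f : V → ℝ} (hf : Measurable f) :
    Integrable f ↔ Integrable (fun q =>
      parabolicJacobian (finrank ℝ (ℝ ∙ ν)ᗮ) p q.2.1 * f (parabolicMap ν p q))
        (parabolicMeasure ν) := by
  have hm := measurable_parabolicMap ν p
  have hJ := measurable_parabolicJacobian (finrank ℝ (ℝ ∙ ν)ᗮ) p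
  conv_lhs => rw [← map_parabolicMap ν hν hp]
  rw [integrable_map_measure hf.aestronglyMeasurable hm.aemeasurable,
    integrable_withDensity_iff_integrable_smul' (by fun_prop) (by simp)]
  refine integrable_congr ?_
  filter_upwards [ae_parabolicMeasure_pos ν] with q hq
  rw [ENNReal.toReal_ofReal (parabolicJacobian_nonneg hp hq)]
  rfl

theorem integral_parabolic (ν : V) (hν : ‖ν‖ = 1) [Nontrivial (ℝ ∙ ν)ᗮ] {p : ℝ} (hp : 0 < p)
    {f : V → ℝ} (hf : Measurable f) :
    ∫ z, f z = ∫ q, parabolicJacobian (finrank ℝ (ℝ ∙ ν)ᗮ) p q.2.1 * f (parabolicMap ν p q)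
        ∂parabolicMeasure ν := by
  have hm := measurable_parabolicMap ν p
  have hJ := measurable_parabolicJacobian (finrank ℝ (ℝ ∙ ν)ᗮ) p
  conv_lhs => rw [← map_parabolicMap ν hν hp]
  rw [integral_map hm.aemeasurable hf.aestronglyMeasurable,
    integral_withDensity_eq_integral_toReal_smul (by fun_prop) (by simp)]
  refine integral_congr_ae ?_
  filter_upwards [ae_parabolicMeasure_pos ν] with q hq
  rw [ENNReal.toReal_ofReal (parabolicJacobian_nonneg hp hq)]
  rfl

end ParabolicCoordinates

section Kernel

theorem rpow_neg_le_of_le_norm {V : Type*} [NormedAddCommGroup V] {c ρ α₀ D : ℝ} (hc : 0 < c)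
    (hρ : 0 < ρ) (hα₀ : 0 < α₀) (hD : 0 ≤ D) {α : ℝ} (hα : α₀ ≤ α) (hα1 : α ≤ 1) {N : V → ℝ}
    (hN : ∀ z, c * ‖z‖ ≤ N z) {z : V} (hz : ρ ≤ ‖z‖) :
    N z ^ (-(D + α)) ≤ max 1 ((1 + ρ⁻¹) / c) ^ (D + 1) * (1 + ‖z‖) ^ (-(D + α₀)) := by
  set K := max 1 ((1 + ρ⁻¹) / c)
  have hz0 : 0 < ‖z‖ := hρ.trans_le hz
  have hNz : 0 < N z := (mul_pos hc hz0).trans_le (hN z)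
  have hK1 : 1 ≤ K := le_max_left _ _
  have hK0 : 0 < K := one_pos.trans_le hK1
  have h1 : 1 + ‖z‖ ≤ K * N z := by
    have h2 : (1 : ℝ) ≤ ρ⁻¹ * ‖z‖ := by rw [inv_mul_eq_div, one_le_div hρ]; exact hz
    calc 1 + ‖z‖ ≤ (1 + ρ⁻¹) * ‖z‖ := by linarith
      _ = (1 + ρ⁻¹) / c * (c * ‖z‖) := by field_simp
      _ ≤ K * N z := mul_le_mul (le_max_right _ _) (hN z) (by positivity) hK0.le
  have h3 : N z ^ (-(D + α)) = K ^ (D + α) * (K * N z) ^ (-(D + α)) := by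
    rw [Real.mul_rpow hK0.le hNz.le, ← mul_assoc, ← Real.rpow_add hK0]
    simp
  rw [h3]
  refine mul_le_mul (Real.rpow_le_rpow_of_exponent_le hK1 (by linarith)) ?_ (by positivity)
    (by positivity)
  calc (K * N z) ^ (-(D + α)) ≤ (1 + ‖z‖) ^ (-(D + α)) :=
        Real.rpow_le_rpow_of_nonpos (by positivity) h1 (by linarith)
    _ ≤ _ := Real.rpow_le_rpow_of_exponent_le (by linarith) (by linarith)

variable {V : Type*} [NormedAddCommGroup V] [InnerProductSpace ℝ V] [FiniteDimensional ℝ V]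
  [MeasurableSpace V] [BorelSpace V]

/-- A function `N` bounded below by a multiple of the norm and positively homogeneous. -/
structure IsNormLike (c : ℝ) (N : V → ℝ) : Prop where
  measurable : Measurable N
  pos : 0 < c
  le : ∀ z, c * ‖z‖ ≤ N z
  smul : ∀ t > 0, ∀ z, N (t • z) = t * N z

/-- A bounded function which, near the origin, vanishes off a paraboloid-shaped neighbourhood of
the hyperplane `ν^⊥`. -/
structure IsParabolic (ν : V) (C ρ : ℝ) (D : V → ℝ) : Prop where
  measurable : Measurable D
  abs_le : ∀ z, |D z| ≤ 2
  eq_zero : ∀ z, ‖z‖ ≤ ρ → C * ‖z‖ ^ 2 < |⟪ν, z⟫| → D z = 0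

theorem integrableOn_far {c ρ α : ℝ} (hρ : 0 < ρ) (hα : 0 < α) (hα1 : α ≤ 1) {N : V → ℝ}
    (hN : IsNormLike c N) {D : V → ℝ} (hD : Measurable D) (hD2 : ∀ z, |D z| ≤ 2) :
    IntegrableOn (fun z => D z / N z ^ ((finrank ℝ V : ℝ) + α)) {z | ρ ≤ ‖z‖} := by
  have hm := hN.measurable
  have hint : Integrable fun z : V => (1 + ‖z‖) ^ (-((finrank ℝ V : ℝ) + α)) :=
    integrable_one_add_norm (by linarith)
  have hs : MeasurableSet {z : V | ρ ≤ ‖z‖} := measurableSet_le measurable_const measurable_norm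
  refine Integrable.mono' (g := fun z => 2 * (max 1 ((1 + ρ⁻¹) / c) ^ ((finrank ℝ V : ℝ) + 1) *
    (1 + ‖z‖) ^ (-((finrank ℝ V : ℝ) + α)))) ((hint.const_mul _).const_mul _).integrableOn
    (Measurable.aestronglyMeasurable (by fun_prop)) ?_
  filter_upwards [ae_restrict_mem hs] with z hz
  have hNz : 0 ≤ N z := (mul_nonneg hN.pos.le (norm_nonneg z)).trans (hN.le z)
  rw [Real.norm_eq_abs, abs_div, abs_of_nonneg (Real.rpow_nonneg hNz _), div_eq_mul_inv,
    ← Real.rpow_neg hNz]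
  exact mul_le_mul (hD2 z)
    (rpow_neg_le_of_le_norm hN.pos hρ hα (Nat.cast_nonneg _) le_rfl hα1 hN.le hz)
    (Real.rpow_nonneg hNz _) (by norm_num)

theorem norm_parabolicMap_sq (ν : V) (hν : ‖ν‖ = 1) (p : ℝ)
    (q : sphere (0 : (ℝ ∙ ν)ᗮ) 1 × ℝ × ℝ) :
    ‖parabolicMap ν p q‖ ^ 2 = (q.2.1 ^ p) ^ 2 + ((q.2.1 ^ p) ^ 2 * q.2.2) ^ 2 := by
  have h0 : ⟪(((q.1 : (ℝ ∙ ν)ᗮ)) : V), ν⟫ = 0 := by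
    rw [real_inner_comm]
    exact (Submodule.mem_orthogonal_singleton_iff_inner_right).1 (q.1 : (ℝ ∙ ν)ᗮ).2
  have h1 : ‖(((q.1 : (ℝ ∙ ν)ᗮ)) : V)‖ = 1 := by
    rw [← Submodule.coe_norm]
    simp
  rw [parabolicMap, norm_add_sq_real, norm_smul, norm_smul, hν, h1, inner_smul_left,
    inner_smul_right, h0]
  simp [mul_pow]

theorem inner_parabolicMap (ν : V) (hν : ‖ν‖ = 1) (p : ℝ)
    (q : sphere (0 : (ℝ ∙ ν)ᗮ) 1 × ℝ × ℝ) :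
    ⟪ν, parabolicMap ν p q⟫ = (q.2.1 ^ p) ^ 2 * q.2.2 := by
  have h0 : ⟪ν, (((q.1 : (ℝ ∙ ν)ᗮ)) : V)⟫ = 0 :=
    (Submodule.mem_orthogonal_singleton_iff_inner_right).1 (q.1 : (ℝ ∙ ν)ᗮ).2
  rw [parabolicMap, inner_add_right, inner_smul_right, inner_smul_right, h0,
    real_inner_self_eq_norm_sq, hν]
  simp

/-- The part of `D / N ^ (d + α)` near the origin. -/
def nearPart (ρ α : ℝ) (D N : V → ℝ) : V → ℝ :=
  indicator (closedBall 0 ρ) fun z => D z / N z ^ ((finrank ℝ V : ℝ) + α)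

/-- The near part in parabolic coordinates, with exponent `p = 1 / (1 - α)`. -/
def nearKernel (ν : V) (ρ α : ℝ) (D N : V → ℝ) (q : sphere (0 : (ℝ ∙ ν)ᗮ) 1 × ℝ × ℝ) : ℝ :=
  indicator (closedBall 0 ρ) D (parabolicMap ν (1 - α)⁻¹ q) /
    N ((((q.1 : (ℝ ∙ ν)ᗮ)) : V) + (q.2.1 ^ (1 - α)⁻¹ * q.2.2) • ν) ^ ((finrank ℝ V : ℝ) + α)

theorem finrank_orthogonal_add_one (ν : V) (hν : ‖ν‖ = 1) :
    finrank ℝ V = finrank ℝ (ℝ ∙ ν)ᗮ + 1 := by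
  have h := (ℝ ∙ ν).finrank_add_finrank_orthogonal
  have hp0 : ν ≠ 0 := by rintro rfl; simp at hν
  rw [finrank_span_singleton hp0] at h
  omega

theorem jacobian_mul_nearPart (ν : V) (hν : ‖ν‖ = 1) {c ρ α : ℝ} (hα1 : α < 1) {N : V → ℝ}
    (hN : IsNormLike c N) (D : V → ℝ) (q : sphere (0 : (ℝ ∙ ν)ᗮ) 1 × ℝ × ℝ) (hq : 0 < q.2.1) :
    (1 - α) * (parabolicJacobian (finrank ℝ (ℝ ∙ ν)ᗮ) (1 - α)⁻¹ q.2.1 *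
      nearPart ρ α D N (parabolicMap ν (1 - α)⁻¹ q)) = nearKernel ν ρ α D N q := by
  have h1α : 0 < 1 - α := by linarith
  unfold nearPart nearKernel
  by_cases hz : parabolicMap ν (1 - α)⁻¹ q ∈ closedBall 0 ρ
  swap
  · simp [hz]
  rw [indicator_of_mem hz, indicator_of_mem hz]
  set t := q.2.1 ^ (1 - α)⁻¹ with ht_def
  have ht : 0 < t := Real.rpow_pos_of_pos hq _
  set w := (((q.1 : (ℝ ∙ ν)ᗮ)) : V) + (t * q.2.2) • ν with hw
  have hpar : parabolicMap ν (1 - α)⁻¹ q = t • w := by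
    rw [parabolicMap, hw, smul_add, smul_smul, ← mul_assoc, ← pow_two]
  have hNw : 0 ≤ N w := (mul_nonneg hN.pos.le (norm_nonneg w)).trans (hN.le w)
  have key : (1 - α) * parabolicJacobian (finrank ℝ (ℝ ∙ ν)ᗮ) (1 - α)⁻¹ q.2.1 =
      t ^ ((finrank ℝ V : ℝ) + α) := by
    rw [parabolicJacobian, ← ht_def, ← finrank_orthogonal_add_one ν hν, Real.rpow_add ht,
      Real.rpow_natCast, ← mul_assoc, ← mul_assoc, mul_inv_cancel₀ h1α.ne', one_mul, mul_comm]
    congr 1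
    rw [ht_def, ← Real.rpow_mul hq.le]
    congr 1
    field_simp
    ring
  rw [← mul_assoc, key]
  conv_lhs => rw [hpar, hN.smul t ht w, Real.mul_rpow ht.le hNw, ← hpar]
  have : t ^ ((finrank ℝ V : ℝ) + α) ≠ 0 := (Real.rpow_pos_of_pos ht _).ne'
  field_simp

/-- An integrable bound of `nearKernel`. -/
def kernelBound (ν : V) (c C : ℝ) : sphere (0 : (ℝ ∙ ν)ᗮ) 1 × ℝ × ℝ → ℝ :=
  indicator (univ ×ˢ (Ioc 0 1 ×ˢ Icc (-(2 * C)) (2 * C)))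
    fun _ => 2 * max 1 c⁻¹ ^ ((finrank ℝ V : ℝ) + 1)

theorem integrable_kernelBound (ν : V) (c C : ℝ) :
    Integrable (kernelBound ν c C) (parabolicMeasure ν) := by
  refine (integrable_indicator_iff (MeasurableSet.univ.prod
    (measurableSet_Ioc.prod measurableSet_Icc))).2 (integrableOn_const (ne_of_lt ?_))
  rw [parabolicMeasure, Measure.prod_prod, Measure.prod_prod]
  refine ENNReal.mul_lt_top (measure_lt_top _ _) (ENNReal.mul_lt_top ?_ measure_Icc_lt_top)
  exact (Measure.restrict_apply_le _ _).trans_lt measure_Ioc_lt_top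

theorem norm_nearKernel_le (ν : V) (hν : ‖ν‖ = 1) {c ρ α C : ℝ} (hρ1 : ρ ≤ 1) (hC : 0 ≤ C)
    (hCρ : C * ρ ≤ 1 / 2) (hα : 0 < α) (hα1 : α < 1) {N D : V → ℝ}
    (hN : IsNormLike c N) (hD : IsParabolic ν C ρ D)
    (q : sphere (0 : (ℝ ∙ ν)ᗮ) 1 × ℝ × ℝ) (hq : 0 < q.2.1) :
    ‖nearKernel ν ρ α D N q‖ ≤ kernelBound ν c C q := by
  have h1α : 0 < 1 - α := by linarith
  have hK : 1 ≤ max 1 c⁻¹ := le_max_left _ _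
  have hbound0 : 0 ≤ kernelBound ν c C q := indicator_nonneg (fun _ _ => by positivity) q
  set z := parabolicMap ν (1 - α)⁻¹ q with hz_def
  by_cases hz : z ∈ closedBall 0 ρ ∧ D z ≠ 0
  swap
  · have : indicator (closedBall 0 ρ) D z = 0 := by
      by_cases h : z ∈ closedBall 0 ρ
      · rw [indicator_of_mem h]; by_contra h'; exact hz ⟨h, h'⟩
      · rw [indicator_of_notMem h]
    rw [nearKernel, this]
    simpa using hbound0
  obtain ⟨hzρ, hDz⟩ := hz
  rw [mem_closedBall_zero_iff] at hzρ
  have hpar : |⟪ν, z⟫| ≤ C * ‖z‖ ^ 2 := by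
    by_contra h
    exact hDz (hD.eq_zero z hzρ (not_le.1 h))
  rw [hz_def, inner_parabolicMap ν hν, norm_parabolicMap_sq ν hν, abs_mul] at hpar
  have hnsq : ‖z‖ ^ 2 = _ := norm_parabolicMap_sq ν hν (1 - α)⁻¹ q
  set t := q.2.1 ^ (1 - α)⁻¹ with ht_def
  have ht : 0 < t := Real.rpow_pos_of_pos hq _
  set η := q.2.2
  have hz2 : ‖z‖ ^ 2 ≤ ρ ^ 2 := pow_le_pow_left₀ (norm_nonneg _) hzρ 2
  have hρ0 : 0 ≤ ρ := (norm_nonneg z).trans hzρ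
  have htρ : t ≤ ρ := (le_abs_self t).trans (abs_le_of_sq_le_sq
    (by nlinarith [sq_nonneg (t ^ 2 * η)] : t ^ 2 ≤ ρ ^ 2) hρ0)
  have ht2η : t ^ 2 * |η| ≤ ρ := by
    have : (t ^ 2 * |η|) ^ 2 ≤ ρ ^ 2 := by
      rw [mul_pow, sq_abs, ← mul_pow]; nlinarith [sq_nonneg t]
    exact (le_abs_self _).trans (abs_le_of_sq_le_sq this hρ0)
  have hη : |η| ≤ 2 * C := by
    rw [abs_of_pos (pow_pos ht 2)] at hpar
    have h1 : t ^ 2 * |η| ≤ t ^ 2 * (C * (1 + t ^ 2 * |η| * |η|)) := by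
      have : t ^ 2 * (C * (1 + t ^ 2 * |η| * |η|)) = C * (t ^ 2 + (t ^ 2 * η) ^ 2) := by
        rw [mul_pow, ← sq_abs η]; ring
      rwa [this]
    have h2 := le_of_mul_le_mul_left h1 (pow_pos ht 2)
    have h3 : C * (t ^ 2 * |η|) ≤ 1 / 2 := (mul_le_mul_of_nonneg_left ht2η hC).trans hCρ
    nlinarith [abs_nonneg η]
  have hs1 : q.2.1 ≤ 1 := by
    by_contra h
    have : 1 < t := Real.one_lt_rpow (not_le.1 h) (inv_pos.2 h1α)
    linarith
  have hmem : q ∈ (univ : Set (sphere (0 : (ℝ ∙ ν)ᗮ) 1)) ×ˢ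
      (Ioc (0 : ℝ) 1 ×ˢ Icc (-(2 * C)) (2 * C)) := ⟨trivial, ⟨hq, hs1⟩, abs_le.1 hη⟩
  rw [kernelBound, indicator_of_mem hmem, nearKernel, ← hz_def,
    indicator_of_mem (mem_closedBall_zero_iff.2 hzρ), ← ht_def]
  set w := (((q.1 : (ℝ ∙ ν)ᗮ)) : V) + (t * q.2.2) • ν with hw
  have hw1 : 1 ≤ ‖w‖ := by
    have h2 : ‖z‖ ^ 2 = t ^ 2 * ‖w‖ ^ 2 := by
      have : z = t • w := by
        rw [hz_def, parabolicMap, hw, smul_add, smul_smul, ← mul_assoc, ← pow_two]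
      rw [this, norm_smul, mul_pow, Real.norm_eq_abs, sq_abs]
    have h3 : t ^ 2 * 1 ≤ t ^ 2 * ‖w‖ ^ 2 := by
      rw [← h2, hnsq]; nlinarith [sq_nonneg (t ^ 2 * η)]
    have h4 := le_of_mul_le_mul_left h3 (pow_pos ht 2)
    nlinarith [norm_nonneg w]
  have hNw : c ≤ N w := (by nlinarith [hN.pos] : c ≤ c * ‖w‖).trans (hN.le w)
  have hNw0 : 0 < N w := hN.pos.trans_le hNw
  rw [Real.norm_eq_abs, abs_div, abs_of_pos (Real.rpow_pos_of_pos hNw0 _), div_eq_mul_inv]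
  refine mul_le_mul (hD.abs_le z) ?_ (by positivity) (by norm_num)
  rw [← Real.inv_rpow hNw0.le]
  calc (N w)⁻¹ ^ ((finrank ℝ V : ℝ) + α) ≤ max 1 c⁻¹ ^ ((finrank ℝ V : ℝ) + α) := by
        refine Real.rpow_le_rpow (by positivity) ?_ (by positivity)
        exact (inv_anti₀ hN.pos hNw).trans (le_max_right _ _)
    _ ≤ _ := Real.rpow_le_rpow_of_exponent_le hK (by linarith)

theorem measurable_nearPart {c ρ α : ℝ} {N D : V → ℝ} (hN : IsNormLike c N) (hD : Measurable D) :
    Measurable (nearPart ρ α D N) := by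
  have := hN.measurable
  exact Measurable.indicator (by fun_prop) measurableSet_closedBall

theorem measurable_nearKernel (ν : V) {c ρ α : ℝ} {N D : V → ℝ} (hN : IsNormLike c N)
    (hD : Measurable D) : Measurable (nearKernel ν ρ α D N) := by
  have h1 := hN.measurable
  have h2 := measurable_parabolicMap ν (1 - α)⁻¹
  have h3 : Measurable (indicator (closedBall 0 ρ) D) := hD.indicator measurableSet_closedBall
  have h4 : Measurable fun q : sphere (0 : (ℝ ∙ ν)ᗮ) 1 × ℝ × ℝ => ((q.1 : (ℝ ∙ ν)ᗮ) : V) :=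
    (continuous_subtype_val.comp (continuous_subtype_val.comp continuous_fst)).measurable
  unfold nearKernel
  fun_prop

theorem integrable_nearPart (ν : V) (hν : ‖ν‖ = 1) [Nontrivial (ℝ ∙ ν)ᗮ] {c ρ α C : ℝ}
    (hρ1 : ρ ≤ 1) (hC : 0 ≤ C) (hCρ : C * ρ ≤ 1 / 2) (hα : 0 < α) (hα1 : α < 1) {N D : V → ℝ}
    (hN : IsNormLike c N) (hD : IsParabolic ν C ρ D) : Integrable (nearPart ρ α D N) := by
  have h1α : 0 < 1 - α := by linarith
  rw [integrable_iff_parabolic ν hν (inv_pos.2 h1α) (measurable_nearPart hN hD.measurable)]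
  have h : Integrable (nearKernel ν ρ α D N) (parabolicMeasure ν) := by
    refine (integrable_kernelBound ν c C).mono'
      (measurable_nearKernel ν hN hD.measurable).aestronglyMeasurable ?_
    filter_upwards [ae_parabolicMeasure_pos ν] with q hq
    exact norm_nearKernel_le ν hν hρ1 hC hCρ hα hα1 hN hD q hq
  refine (h.const_mul (1 - α)⁻¹).congr ?_
  filter_upwards [ae_parabolicMeasure_pos ν] with q hq
  rw [← jacobian_mul_nearPart ν hν hα1 hN D q hq, inv_mul_cancel_left₀ h1α.ne']

theorem integral_nearPart (ν : V) (hν : ‖ν‖ = 1) [Nontrivial (ℝ ∙ ν)ᗮ] {c ρ α : ℝ}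
    (hα1 : α < 1) {N D : V → ℝ} (hN : IsNormLike c N) (hD : Measurable D) :
    (1 - α) * ∫ z, nearPart ρ α D N z = ∫ q, nearKernel ν ρ α D N q ∂parabolicMeasure ν := by
  have h1α : 0 < 1 - α := by linarith
  rw [integral_parabolic ν hν (inv_pos.2 h1α) (measurable_nearPart hN hD), ← integral_const_mul]
  refine integral_congr_ae ?_
  filter_upwards [ae_parabolicMeasure_pos ν] with q hq
  exact jacobian_mul_nearPart ν hν hα1 hN D q hq

theorem integrable_of_isParabolic (ν : V) (hν : ‖ν‖ = 1) [Nontrivial (ℝ ∙ ν)ᗮ] {c ρ α C : ℝ}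
    (hρ : 0 < ρ) (hρ1 : ρ ≤ 1) (hC : 0 ≤ C) (hCρ : C * ρ ≤ 1 / 2) (hα : 0 < α) (hα1 : α < 1)
    {N D : V → ℝ} (hN : IsNormLike c N) (hD : IsParabolic ν C ρ D) :
    Integrable fun z => D z / N z ^ ((finrank ℝ V : ℝ) + α) := by
  rw [← integrableOn_univ, ← union_compl_self (closedBall (0 : V) ρ)]
  refine IntegrableOn.union ?_ ?_
  · exact (integrable_indicator_iff measurableSet_closedBall).1
      (integrable_nearPart ν hν hρ1 hC hCρ hα hα1 hN hD)
  · refine (integrableOn_far hρ hα hα1.le hN hD.measurable hD.abs_le).mono_set fun z hz => ?_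
    rw [mem_compl_iff, mem_closedBall_zero_iff, not_le] at hz
    exact hz.le

end Kernel

section ParabolicLimit

theorem integral_sign_sub_sign (q : ℝ) :
    ∫ η : ℝ, ((if q < η then (1 : ℝ) else -1) - (if 0 < η then 1 else -1)) = -2 * q := by
  have h : (fun η : ℝ => (if q < η then (1 : ℝ) else -1) - (if 0 < η then 1 else -1)) =
      fun η => (Ioc 0 q).indicator (fun _ => (-2 : ℝ)) η + (Ioc q 0).indicator (fun _ => (2 : ℝ)) η := by
    ext η
    by_cases h1 : q < η <;> by_cases h2 : 0 < η <;>
      simp [indicator, h1, h2, not_le.2, not_lt.1] <;>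
      grind
  rw [h, integral_add, integral_indicator_const _ measurableSet_Ioc,
    integral_indicator_const _ measurableSet_Ioc]
  · rcases le_total 0 q with hq | hq
    · simp [hq]; ring
    · simp [hq]; ring
  · exact (integrable_indicator_iff measurableSet_Ioc).2 (integrableOn_const (by simp))
  · exact (integrable_indicator_iff measurableSet_Ioc).2 (integrableOn_const (by simp))

theorem tendsto_rpow_inv_one_sub {α : ℕ → ℝ} (hα1 : ∀ n, α n < 1) (hα : Tendsto α atTop (𝓝 1))
    {s : ℝ} (hs : 0 < s) (hs1 : s < 1) :
    Tendsto (fun n => s ^ (1 - α n)⁻¹) atTop (𝓝[>] 0) := by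
  refine tendsto_nhdsWithin_iff.2 ⟨?_, Eventually.of_forall fun n => Real.rpow_pos_of_pos hs _⟩
  have h1 : Tendsto (fun n => (1 - α n)⁻¹) atTop atTop := by
    refine tendsto_inv_nhdsGT_zero.comp (tendsto_nhdsWithin_iff.2 ⟨?_, ?_⟩)
    · simpa using hα.const_sub 1
    · exact Eventually.of_forall fun n => sub_pos.2 (hα1 n)
  exact (tendsto_rpow_atTop_of_base_lt_one s (by linarith) hs1).comp h1

variable {V : Type*} [NormedAddCommGroup V] [InnerProductSpace ℝ V] [FiniteDimensional ℝ V]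
  [MeasurableSpace V] [BorelSpace V]

/-- The limit of `nearKernel` as the exponent tends to one. -/
def limitKernel (ν : V) (N : V → ℝ) (q : (ℝ ∙ ν)ᗮ → ℝ)
    (x : sphere (0 : (ℝ ∙ ν)ᗮ) 1 × ℝ × ℝ) : ℝ :=
  (Iio (1 : ℝ)).indicator 1 x.2.1 *
    (((if q x.1 < x.2.2 then (1 : ℝ) else -1) - (if 0 < x.2.2 then 1 else -1)) /
      N ((x.1 : (ℝ ∙ ν)ᗮ) : V) ^ ((finrank ℝ V : ℝ) + 1))

theorem ae_parabolicMeasure_ne (ν : V) {q : (ℝ ∙ ν)ᗮ → ℝ} (hq : Measurable q) :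
    ∀ᵐ x ∂parabolicMeasure ν, x.2.1 ≠ 1 ∧ x.2.2 ≠ q x.1 := by
  refine Filter.Eventually.and ?_ ?_
  · refine ae_iff.2 ?_
    have : {x : sphere (0 : (ℝ ∙ ν)ᗮ) 1 × ℝ × ℝ | ¬ x.2.1 ≠ 1} = univ ×ˢ ({1} ×ˢ univ) := by
      ext x; simp
    rw [this, parabolicMeasure, Measure.prod_prod, Measure.prod_prod,
      Measure.restrict_apply (measurableSet_singleton _),
      measure_mono_null inter_subset_left (measure_singleton _)]
    simp
  · refine ae_iff.2 ?_
    have hm : MeasurableSet {x : sphere (0 : (ℝ ∙ ν)ᗮ) 1 × ℝ × ℝ | ¬ x.2.2 ≠ q x.1} := by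
      simp only [not_not]
      exact measurableSet_eq_fun (by fun_prop) (by fun_prop)
    rw [parabolicMeasure, Measure.measure_prod_null hm]
    refine Eventually.of_forall fun e => ?_
    have : Prod.mk e ⁻¹' {x : sphere (0 : (ℝ ∙ ν)ᗮ) 1 × ℝ × ℝ | ¬ x.2.2 ≠ q x.1} =
        univ ×ˢ {q e} := by
      ext x; simp
    change _ = (0 : ℝ≥0∞)
    simp only []
    rw [this, Measure.prod_prod]
    simp

theorem integral_limitKernel (ν : V) {N : V → ℝ} {q : (ℝ ∙ ν)ᗮ → ℝ}
    (h : Integrable (limitKernel ν N q) (parabolicMeasure ν)) :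
    ∫ x, limitKernel ν N q x ∂parabolicMeasure ν =
      ∫ e : sphere (0 : (ℝ ∙ ν)ᗮ) 1, -2 * q e / N ((e : (ℝ ∙ ν)ᗮ) : V) ^ ((finrank ℝ V : ℝ) + 1)
        ∂(volume : Measure (ℝ ∙ ν)ᗮ).toSphere := by
  rw [parabolicMeasure] at h ⊢
  rw [integral_prod _ h]
  refine integral_congr_ae (Eventually.of_forall fun e => ?_)
  simp only [limitKernel]
  rw [integral_prod_mul (fun s : ℝ => (Iio (1 : ℝ)).indicator (1 : ℝ → ℝ) s)
    (fun η : ℝ => ((if q e < η then (1 : ℝ) else -1) - (if 0 < η then 1 else -1)) /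
      N ((e : (ℝ ∙ ν)ᗮ) : V) ^ ((finrank ℝ V : ℝ) + 1)), integral_div, integral_sign_sub_sign,
    integral_indicator_one measurableSet_Iio]
  simp [measureReal_def, Measure.restrict_apply, Iio_inter_Ioi]

theorem tendsto_integral_of_isParabolic (ν : V) (hν : ‖ν‖ = 1) [Nontrivial (ℝ ∙ ν)ᗮ]
    {c ρ C : ℝ} (hρ : 0 < ρ) (hρ1 : ρ ≤ 1) (hC : 0 ≤ C) (hCρ : C * ρ ≤ 1 / 2)
    {α : ℕ → ℝ} (hα_mem : ∀ n, α n ∈ Ioo (0 : ℝ) 1) (hα : Tendsto α atTop (𝓝 1))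
    {N D : ℕ → V → ℝ} {N' : V → ℝ} (hN : ∀ n, IsNormLike c (N n))
    (hD : ∀ n, IsParabolic ν C ρ (D n)) {q : (ℝ ∙ ν)ᗮ → ℝ} (hq : Measurable q)
    (hNlim : ∀ w, Tendsto (fun x : ℕ × V => N x.1 x.2) (atTop ×ˢ 𝓝 w) (𝓝 (N' w)))
    (hDlim : ∀ e : sphere (0 : (ℝ ∙ ν)ᗮ) 1, ∀ η, η ≠ q e →
      Tendsto (fun x : ℕ × ℝ => D x.1 (x.2 • ((e : (ℝ ∙ ν)ᗮ) : V) + (x.2 ^ 2 * η) • ν))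
        (atTop ×ˢ 𝓝[>] 0)
        (𝓝 ((if q e < η then (1 : ℝ) else -1) - (if 0 < η then 1 else -1)))) :
    Tendsto (fun n => (1 - α n) * ∫ z, D n z / N n z ^ ((finrank ℝ V : ℝ) + α n)) atTop
      (𝓝 (∫ e : sphere (0 : (ℝ ∙ ν)ᗮ) 1,
        -2 * q e / N' ((e : (ℝ ∙ ν)ᗮ) : V) ^ ((finrank ℝ V : ℝ) + 1)
          ∂(volume : Measure (ℝ ∙ ν)ᗮ).toSphere)) := by
  have hlim : ∀ᵐ x ∂parabolicMeasure ν, Tendsto (fun n => nearKernel ν ρ (α n) (D n) (N n) x) atTop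
      (𝓝 (limitKernel ν N' q x)) := by
    filter_upwards [ae_parabolicMeasure_pos ν, ae_parabolicMeasure_ne ν hq] with x hx hx'
    rcases lt_or_gt_of_ne hx'.1 with hs | hs
    swap
    · have h1 : limitKernel ν N' q x = 0 := by
        rw [limitKernel, indicator_of_notMem (by simpa using hs.le), zero_mul]
      have h2 : ∀ n, nearKernel ν ρ (α n) (D n) (N n) x = 0 := fun n => by
        have := norm_nearKernel_le ν hν hρ1 hC hCρ (hα_mem n).1 (hα_mem n).2 (hN n) (hD n) x hx
        rw [kernelBound, indicator_of_notMem (by simp [hs])] at this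
        simpa using this
      simp_rw [h1, h2]
      exact tendsto_const_nhds
    have ht := tendsto_rpow_inv_one_sub (fun n => (hα_mem n).2) hα hx hs
    have ht0 := tendsto_nhds_of_tendsto_nhdsWithin ht
    have hz : Tendsto (fun n => parabolicMap ν (1 - α n)⁻¹ x) atTop (𝓝 0) := by
      have h1 := (ht0.smul_const ((x.1 : (ℝ ∙ ν)ᗮ) : V)).add
        (((ht0.pow 2).mul_const x.2.2).smul_const ν)
      simpa [parabolicMap] using h1
    have hDn : Tendsto (fun n => indicator (closedBall 0 ρ) (D n) (parabolicMap ν (1 - α n)⁻¹ x))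
        atTop (𝓝 ((if q x.1 < x.2.2 then (1 : ℝ) else -1) - (if 0 < x.2.2 then 1 else -1))) := by
      refine Tendsto.congr' ?_ ((hDlim x.1 x.2.2 hx'.2).comp (tendsto_id.prodMk ht))
      filter_upwards [hz.eventually (closedBall_mem_nhds 0 hρ)] with n hn
      exact (indicator_of_mem (s := closedBall 0 ρ) hn (D n)).symm
    have hw : Tendsto (fun n => ((x.1 : (ℝ ∙ ν)ᗮ) : V) + (x.2.1 ^ (1 - α n)⁻¹ * x.2.2) • ν) atTop
        (𝓝 ((x.1 : (ℝ ∙ ν)ᗮ) : V)) := by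
      simpa using ((ht0.mul_const x.2.2).smul_const ν).const_add ((x.1 : (ℝ ∙ ν)ᗮ) : V)
    have hNn := (hNlim _).comp (tendsto_id.prodMk hw)
    have hNpos : 0 < N' ((x.1 : (ℝ ∙ ν)ᗮ) : V) := by
      have h1 : Tendsto (fun n => N n ((x.1 : (ℝ ∙ ν)ᗮ) : V)) atTop
          (𝓝 (N' ((x.1 : (ℝ ∙ ν)ᗮ) : V))) :=
        (hNlim _).comp (tendsto_id.prodMk tendsto_const_nhds)
      have h2 : ‖((x.1 : (ℝ ∙ ν)ᗮ) : V)‖ = 1 := by rw [← Submodule.coe_norm]; simp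
      refine (hN 0).pos.trans_le (ge_of_tendsto' h1 fun n => ?_)
      have := (hN n).le ((x.1 : (ℝ ∙ ν)ᗮ) : V)
      rwa [h2, mul_one] at this
    have h3 := hDn.div (hNn.rpow (hα.const_add (finrank ℝ V : ℝ)) (Or.inl hNpos.ne'))
      (Real.rpow_pos_of_pos hNpos _).ne'
    have h4 : limitKernel ν N' q x = ((if q x.1 < x.2.2 then (1 : ℝ) else -1) -
        (if 0 < x.2.2 then 1 else -1)) / N' ((x.1 : (ℝ ∙ ν)ᗮ) : V) ^ ((finrank ℝ V : ℝ) + 1) := by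
      rw [limitKernel, indicator_of_mem (by simpa using hs), Pi.one_apply, one_mul]
    rw [h4]
    exact h3
  have hbound : ∀ n, ∀ᵐ x ∂parabolicMeasure ν,
      ‖nearKernel ν ρ (α n) (D n) (N n) x‖ ≤ kernelBound ν c C x := fun n => by
    filter_upwards [ae_parabolicMeasure_pos ν] with x hx
    exact norm_nearKernel_le ν hν hρ1 hC hCρ (hα_mem n).1 (hα_mem n).2 (hN n) (hD n) x hx
  have hmeas : ∀ n, AEStronglyMeasurable (nearKernel ν ρ (α n) (D n) (N n)) (parabolicMeasure ν) :=
    fun n => (measurable_nearKernel ν (hN n) (hD n).measurable).aestronglyMeasurable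
  have hnear : Tendsto (fun n => (1 - α n) * ∫ z, nearPart ρ (α n) (D n) (N n) z) atTop
      (𝓝 (∫ x, limitKernel ν N' q x ∂parabolicMeasure ν)) := by
    simp_rw [fun n => integral_nearPart ν hν (ρ := ρ) (hα_mem n).2 (hN n) (hD n).measurable]
    exact tendsto_integral_of_dominated_convergence _ hmeas (integrable_kernelBound ν c C) hbound hlim
  have hint : Integrable (limitKernel ν N' q) (parabolicMeasure ν) := by
    refine (integrable_kernelBound ν c C).mono' (aestronglyMeasurable_of_tendsto_ae _ hmeas hlim) ?_
    filter_upwards [hlim, ae_all_iff.2 hbound] with x h1 h2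
    exact le_of_tendsto' h1.norm h2
  rw [integral_limitKernel ν hint] at hnear
  have hfar : Tendsto (fun n => (1 - α n) *
      ∫ z in (closedBall (0 : V) ρ)ᶜ, D n z / N n z ^ ((finrank ℝ V : ℝ) + α n)) atTop (𝓝 0) := by
    set g : V → ℝ := fun z => 2 * (max 1 ((1 + ρ⁻¹) / c) ^ ((finrank ℝ V : ℝ) + 1) *
      (1 + ‖z‖) ^ (-((finrank ℝ V : ℝ) + 1 / 2)))
    have hg : Integrable g :=
      ((integrable_one_add_norm (by linarith)).const_mul _).const_mul _
    have h1 : Tendsto (fun n => (1 - α n) * ∫ z in (closedBall (0 : V) ρ)ᶜ, g z) atTop (𝓝 0) := by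
      simpa using (hα.const_sub 1).mul_const (∫ z in (closedBall (0 : V) ρ)ᶜ, g z)
    refine squeeze_zero_norm' ?_ h1
    filter_upwards [hα.eventually (lt_mem_nhds (by norm_num : (1 / 2 : ℝ) < 1))] with n hn
    rw [norm_mul, Real.norm_of_nonneg (sub_nonneg.2 (hα_mem n).2.le)]
    refine mul_le_mul_of_nonneg_left ?_ (sub_nonneg.2 (hα_mem n).2.le)
    refine norm_integral_le_of_norm_le hg.integrableOn ?_
    filter_upwards [ae_restrict_mem measurableSet_closedBall.compl] with z hz
    rw [mem_compl_iff, mem_closedBall_zero_iff, not_le] at hz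
    have hNz : 0 ≤ N n z := (mul_nonneg (hN n).pos.le (norm_nonneg z)).trans ((hN n).le z)
    rw [Real.norm_eq_abs, abs_div, abs_of_nonneg (Real.rpow_nonneg hNz _), div_eq_mul_inv,
      ← Real.rpow_neg hNz]
    exact mul_le_mul ((hD n).abs_le z)
      (rpow_neg_le_of_le_norm (hN n).pos hρ (by norm_num) (Nat.cast_nonneg _) hn.le
        (hα_mem n).2.le (hN n).le hz.le)
      (Real.rpow_nonneg hNz _) (by norm_num)
  have := hnear.add hfar
  rw [add_zero] at this
  refine this.congr fun n => ?_
  rw [← mul_add, nearPart, integral_indicator measurableSet_closedBall,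
    integral_add_compl measurableSet_closedBall
      (integrable_of_isParabolic ν hν hρ hρ1 hC hCρ (hα_mem n).1 (hα_mem n).2 (hN n) (hD n))]

end ParabolicLimit

section TruncatedCurvature

section

variable {V : Type*} [NormedAddCommGroup V] [InnerProductSpace ℝ V] [FiniteDimensional ℝ V]
  [MeasurableSpace V] [BorelSpace V]

/-- The signed indicator of the half-space `{z | ⟪ν, z⟫ ≤ 0}`. -/
def halfSpaceSign (ν z : V) : ℝ := if 0 < ⟪ν, z⟫ then 1 else -1

theorem measurable_halfSpaceSign (ν : V) : Measurable (halfSpaceSign ν) := by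
  unfold halfSpaceSign
  refine Measurable.ite ?_ measurable_const measurable_const
  exact measurableSet_lt measurable_const (by fun_prop)

theorem abs_halfSpaceSign (ν z : V) : |halfSpaceSign ν z| = 1 := by
  unfold halfSpaceSign; split_ifs <;> simp

theorem ae_inner_ne_zero {ν : V} (hν : ν ≠ 0) : ∀ᵐ z : V, ⟪ν, z⟫ ≠ 0 := by
  have h : (ℝ ∙ ν)ᗮ ≠ ⊤ := by
    intro h
    rw [Submodule.orthogonal_eq_top_iff, Submodule.span_singleton_eq_bot] at h
    exact hν h
  have h2 := Measure.addHaar_submodule (volume : Measure V) _ h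
  refine measure_mono_null (fun z hz => ?_) h2
  simp only [mem_compl_iff, mem_ofPred_eq, not_not] at hz
  exact (Submodule.mem_orthogonal_singleton_iff_inner_right).2 hz

theorem setIntegral_halfSpaceSign {ν : V} (hν : ν ≠ 0) {N : V → ℝ} (hN : ∀ z, N (-z) = N z)
    {s : Set V} (hs : MeasurableSet s) (hsymm : ∀ z, -z ∈ s ↔ z ∈ s) (p : ℝ) :
    ∫ z in s, halfSpaceSign ν z / N z ^ p = 0 := by
  rw [← integral_indicator hs]
  set g := s.indicator fun z => halfSpaceSign ν z / N z ^ p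
  have h1 : ∫ z, g (-z) = ∫ z, g z := integral_neg_eq_self g volume
  have h2 : ∫ z, g (-z) = ∫ z, -g z := by
    refine integral_congr_ae ?_
    filter_upwards [ae_inner_ne_zero hν] with z hz
    simp only [g]
    by_cases hzs : z ∈ s
    · rw [indicator_of_mem hzs, indicator_of_mem ((hsymm z).2 hzs), hN, ← neg_div]
      congr 1
      unfold halfSpaceSign
      rw [inner_neg_right]
      rcases lt_or_gt_of_ne hz with h | h
      · rw [if_pos (by linarith), if_neg (by linarith)]; norm_num
      · rw [if_neg (by linarith), if_pos h]
    · rw [indicator_of_notMem hzs, indicator_of_notMem (fun h => hzs ((hsymm z).1 h)), neg_zero]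
  rw [integral_neg] at h2
  linarith

theorem tendsto_setIntegral_norm_le [Nontrivial V] {f : V → ℝ} (hf : Integrable f)
    (A : V ≃L[ℝ] V) :
    Tendsto (fun r : ℝ => ∫ z in {z | r ≤ ‖A z‖}, f z) (𝓝[>] 0) (𝓝 (∫ z, f z)) := by
  have hs : ∀ r : ℝ, MeasurableSet {z : V | r ≤ ‖A z‖} := fun r =>
    measurableSet_le measurable_const (by fun_prop)
  simp_rw [fun r => (integral_indicator (f := f) (μ := volume) (hs r)).symm]
  refine tendsto_integral_filter_of_dominated_convergence (fun z => ‖f z‖)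
    (Eventually.of_forall fun r => hf.aestronglyMeasurable.indicator (hs r))
    (Eventually.of_forall fun r => Eventually.of_forall fun z => norm_indicator_le_norm_self _ _)
    hf.norm ?_
  filter_upwards [compl_mem_ae_iff.2 (measure_singleton (0 : V))] with z hz
  refine tendsto_const_nhds.congr' ?_
  have hz0 : 0 < ‖A z‖ := norm_pos_iff.2 fun h => hz (by simpa using h)
  filter_upwards [nhdsWithin_le_nhds (gt_mem_nhds hz0)] with r hr
  have hr : r < ‖A z‖ := hr
  exact (indicator_of_mem (s := {z : V | r ≤ ‖A z‖}) hr.le f).symm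

theorem setIntegral_eq_abs_det_mul (A : V ≃L[ℝ] V) (x : V) (f : V → ℝ) (s : Set V) :
    ∫ y in s, f y = |LinearMap.det ((A : V →L[ℝ] V) : V →ₗ[ℝ] V)| *
      ∫ z in {z | x + A z ∈ s}, f (x + A z) := by
  have hdet : LinearMap.det ((A : V →L[ℝ] V) : V →ₗ[ℝ] V) ≠ 0 :=
    A.toLinearEquiv.isUnit_det'.ne_zero
  have h1 := (measurePreserving_add_left (volume : Measure V) x).setIntegral_preimage_emb
    (Homeomorph.addLeft x).measurableEmbedding f s
  rw [← h1]
  have h2 := Measure.map_linearMap_addHaar_eq_smul_addHaar (volume : Measure V) hdet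
  have h3 := A.toHomeomorph.measurableEmbedding.setIntegral_map (μ := (volume : Measure V))
    (fun z => f (x + z)) ((x + ·) ⁻¹' s)
  have h4 : (Measure.map (A.toHomeomorph) (volume : Measure V)) =
      ENNReal.ofReal |(LinearMap.det ((A : V →L[ℝ] V) : V →ₗ[ℝ] V))⁻¹| • volume := h2
  rw [h4, Measure.restrict_smul, integral_smul_measure, ENNReal.toReal_ofReal (abs_nonneg _),
    abs_inv, smul_eq_mul] at h3
  rw [← mul_right_inj' (inv_ne_zero (abs_ne_zero.2 hdet)), h3,
    inv_mul_cancel_left₀ (abs_ne_zero.2 hdet)]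
  rfl

end

section Body

variable {d : ℕ}

theorem convexBody_mem_nhds_zero {K : ConvexBody (EuclideanSpace ℝ (Fin d))}
    (hK_interior : (interior (K : Set (EuclideanSpace ℝ (Fin d)))).Nonempty)
    (hK_symm : ∀ y ∈ K, -y ∈ K) : (K : Set (EuclideanSpace ℝ (Fin d))) ∈ 𝓝 0 := by
  obtain ⟨y, hy⟩ := hK_interior
  have hneg : -(K : Set (EuclideanSpace ℝ (Fin d))) = K := by
    ext z
    exact ⟨fun h => by simpa using hK_symm _ h, fun h => hK_symm _ h⟩
  have hy' : -y ∈ interior (K : Set (EuclideanSpace ℝ (Fin d))) := by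
    have h := preimage_interior_subset_interior_preimage
      (f := fun z : EuclideanSpace ℝ (Fin d) => -z) (t := (K : Set (EuclideanSpace ℝ (Fin d))))
      continuous_neg
    rw [← hneg]
    exact h (by simpa using hy)
  have := K.convex.interior hy hy' (a := 1 / 2) (b := 1 / 2) (by norm_num) (by norm_num)
    (by norm_num)
  rw [smul_neg, add_neg_cancel] at this
  exact mem_interior_iff_mem_nhds.1 this

theorem exists_mul_norm_le_gauge {K : ConvexBody (EuclideanSpace ℝ (Fin d))}
    (hK : (K : Set (EuclideanSpace ℝ (Fin d))) ∈ 𝓝 0) :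
    ∃ c > 0, ∀ z, c * ‖z‖ ≤ gauge (K : Set (EuclideanSpace ℝ (Fin d))) z := by
  obtain ⟨R, hR, hKR⟩ := K.isCompact.isBounded.subset_closedBall_lt 0 0
  refine ⟨R⁻¹, inv_pos.2 hR, fun z => ?_⟩
  have h := gauge_mono (absorbent_nhds_zero hK) hKR z
  rwa [gauge_closedBall hR.le, div_eq_inv_mul] at h

theorem measurable_signedIndicator {E : Set (EuclideanSpace ℝ (Fin d))} (hE : MeasurableSet E) :
    Measurable (signedIndicator E) := by
  unfold signedIndicator
  exact (measurable_one.indicator hE.compl).sub (measurable_one.indicator hE)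

theorem signedIndicator_of_mem {E : Set (EuclideanSpace ℝ (Fin d))} {y} (h : y ∈ E) :
    signedIndicator E y = -1 := by
  simp [signedIndicator, h]

theorem signedIndicator_of_notMem {E : Set (EuclideanSpace ℝ (Fin d))} {y} (h : y ∉ E) :
    signedIndicator E y = 1 := by
  simp [signedIndicator, h]

theorem abs_signedIndicator (E : Set (EuclideanSpace ℝ (Fin d))) (y) :
    |signedIndicator E y| = 1 := by
  by_cases h : y ∈ E
  · simp [signedIndicator_of_mem h]
  · simp [signedIndicator_of_notMem h]

/-- The difference between the signed indicator of `E`, in the linear coordinates `A` at `x`, and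
that of the half-space with outer normal `ν`. -/
def signDefect (E : Set (EuclideanSpace ℝ (Fin d))) (x ν : EuclideanSpace ℝ (Fin d))
    (A : EuclideanSpace ℝ (Fin d) ≃L[ℝ] EuclideanSpace ℝ (Fin d)) (z : EuclideanSpace ℝ (Fin d)) :
    ℝ :=
  signedIndicator E (x + A z) - halfSpaceSign ν z

theorem integrableOn_curvatureIntegrand {K : ConvexBody (EuclideanSpace ℝ (Fin d))} {c α : ℝ}
    (hN : IsNormLike c (gauge (K : Set (EuclideanSpace ℝ (Fin d))))) (hK_symm : ∀ y ∈ K, -y ∈ K)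
    (hα : 0 < α) (hα1 : α ≤ 1) {E : Set (EuclideanSpace ℝ (Fin d))} (hE : MeasurableSet E)
    (x : EuclideanSpace ℝ (Fin d)) {r : ℝ} (hr : 0 < r) :
    IntegrableOn (curvatureIntegrand K α x E) (ball x r)ᶜ := by
  have h1 := integrableOn_far (D := fun z => signedIndicator E (x + z)) hr hα hα1 hN
    ((measurable_signedIndicator hE).comp (measurable_const_add x))
    (fun z => (abs_signedIndicator E _).le.trans one_le_two)
  rw [← (measurePreserving_add_left volume x).integrableOn_comp_preimage
    (Homeomorph.addLeft x).measurableEmbedding]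
  have h2 : ((x + ·) ⁻¹' (ball x r)ᶜ : Set (EuclideanSpace ℝ (Fin d))) = {z | r ≤ ‖z‖} := by
    ext z; simp
  rw [h2]
  refine h1.congr_fun (fun z _ => ?_) (measurableSet_le measurable_const measurable_norm)
  simp [curvatureIntegrand, gauge_neg hK_symm]

theorem tendsto_truncatedCurvature {K : ConvexBody (EuclideanSpace ℝ (Fin d))}
    (hK_symm : ∀ y ∈ K, -y ∈ K) {A : EuclideanSpace ℝ (Fin d) ≃L[ℝ] EuclideanSpace ℝ (Fin d)}
    {c α ρ C : ℝ} (hN : IsNormLike c fun z => gauge (K : Set (EuclideanSpace ℝ (Fin d))) (A z))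
    (hρ : 0 < ρ) (hρ1 : ρ ≤ 1) (hC : 0 ≤ C) (hCρ : C * ρ ≤ 1 / 2)
    (hα : 0 < α) (hα1 : α < 1) {E : Set (EuclideanSpace ℝ (Fin d))}
    {x ν : EuclideanSpace ℝ (Fin d)} (hν : ‖ν‖ = 1) [Nontrivial (ℝ ∙ ν)ᗮ]
    (hD : IsParabolic ν C ρ (signDefect E x ν A)) :
    Tendsto (truncatedCurvature K α x E) (𝓝[>] 0) (𝓝 (1 / kappa d *
      (|LinearMap.det (((A : EuclideanSpace ℝ (Fin d) →L[ℝ] EuclideanSpace ℝ (Fin d))) :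
        EuclideanSpace ℝ (Fin d) →ₗ[ℝ] EuclideanSpace ℝ (Fin d))| *
      ∫ z, signDefect E x ν A z /
        gauge (K : Set (EuclideanSpace ℝ (Fin d))) (A z) ^ ((d : ℝ) + α)))) := by
  have hν0 : ν ≠ 0 := by rintro rfl; simp at hν
  have : Nontrivial (EuclideanSpace ℝ (Fin d)) := ⟨⟨ν, 0, hν0⟩⟩
  have hint := integrable_of_isParabolic ν hν hρ hρ1 hC hCρ hα hα1 hN hD
  rw [finrank_euclideanSpace_fin] at hint
  refine Tendsto.const_mul _ ?_
  refine ((tendsto_setIntegral_norm_le hint A).const_mul _).congr' ?_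
  filter_upwards [self_mem_nhdsWithin] with r hr
  have hr : 0 < r := hr
  rw [setIntegral_eq_abs_det_mul A x (curvatureIntegrand K α x E)]
  congr 1
  have hset : {z | x + A z ∈ (ball x r)ᶜ} = {z | r ≤ ‖A z‖} := by
    ext z; simp
  have hs : MeasurableSet {z : EuclideanSpace ℝ (Fin d) | r ≤ ‖A z‖} :=
    measurableSet_le measurable_const (by fun_prop)
  have hodd := setIntegral_halfSpaceSign hν0
    (N := fun z => gauge (K : Set (EuclideanSpace ℝ (Fin d))) (A z))
    (fun z => by rw [map_neg, gauge_neg hK_symm]) hs (fun z => by simp) ((d : ℝ) + α)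
  have hfar : IntegrableOn (fun z => halfSpaceSign ν z /
      gauge (K : Set (EuclideanSpace ℝ (Fin d))) (A z) ^ ((d : ℝ) + α)) {z | r ≤ ‖A z‖} := by
    set a := ‖(A : EuclideanSpace ℝ (Fin d) →L[ℝ] EuclideanSpace ℝ (Fin d))‖
    have h1 := integrableOn_far (ρ := r / (a + 1)) (by positivity) hα hα1.le hN
      (measurable_halfSpaceSign ν) (fun z => (abs_halfSpaceSign ν z).le.trans one_le_two)
    rw [finrank_euclideanSpace_fin] at h1
    refine h1.mono_set fun z hz => ?_
    have hz : r ≤ ‖A z‖ := hz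
    have h2 : ‖A z‖ ≤ a * ‖z‖ :=
      (A : EuclideanSpace ℝ (Fin d) →L[ℝ] EuclideanSpace ℝ (Fin d)).le_opNorm z
    simp only [mem_ofPred_eq]
    rw [div_le_iff₀ (by positivity)]
    nlinarith [norm_nonneg z]
  rw [hset, ← add_zero (∫ z in {z | r ≤ ‖A z‖}, _), ← hodd, ← integral_add hint.integrableOn hfar]
  refine setIntegral_congr_fun hs fun z _ => ?_
  simp only [signDefect, curvatureIntegrand, sub_add_cancel_left, gauge_neg hK_symm]
  rw [← add_div, sub_add_cancel]

end Body

end TruncatedCurvature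

open Asymptotics

section Taylor

/-- Second order Taylor expansion, uniform in the base point. -/
theorem isLittleO_taylor_two {V : Type*} [NormedAddCommGroup V] [NormedSpace ℝ V]
    {u : V → ℝ} {x : V} (hu : ContDiffAt ℝ 2 u x) :
    (fun p : V × V => u (p.1 + p.2) - u p.1 - fderiv ℝ u p.1 p.2 -
      1 / 2 * fderiv ℝ (fderiv ℝ u) x p.2 p.2) =o[𝓝 x ×ˢ 𝓝 0] fun p => ‖p.2‖ ^ 2 := by
  set B := fderiv ℝ (fderiv ℝ u) x
  have hsymm : ∀ v w, B v w = B w v := fun v w => (hu.isSymmSndFDerivAt (by simp)).eq v w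
  have hstrict : HasStrictFDerivAt (fderiv ℝ u) B x :=
    (hu.fderiv_right (m := 1) (by norm_num)).hasStrictFDerivAt (by norm_num)
  have hdiff : ∀ᶠ y in 𝓝 x, DifferentiableAt ℝ u y := by
    filter_upwards [hu.eventually (by simp)] with y hy using hy.differentiableAt (by norm_num)
  refine isLittleO_iff.2 fun ε hε => ?_
  have h1 := isLittleO_iff.1 hstrict.isLittleO hε
  rw [nhds_prod_eq, eventually_iff_exists_mem] at h1
  obtain ⟨δ₁, hδ₁, hd⟩ := Metric.eventually_nhds_iff_ball.1 hdiff
  obtain ⟨s, hs, hs'⟩ := h1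
  rw [← nhds_prod_eq] at hs
  obtain ⟨δ₂, hδ₂, hball⟩ := Metric.mem_nhds_iff.1 hs
  set δ := min δ₁ δ₂ / 2
  have hδ : 0 < δ := by positivity
  have hδ1 : 2 * δ ≤ δ₁ := by
    have := min_le_left δ₁ δ₂
    simp only [δ]; linarith
  have hδ2 : 2 * δ ≤ δ₂ := by
    have := min_le_right δ₁ δ₂
    simp only [δ]; linarith
  filter_upwards [prod_mem_prod (ball_mem_nhds x hδ) (ball_mem_nhds (0 : V) hδ)] with ⟨a, w⟩ ⟨ha, hw⟩
  simp only [mem_ball, dist_zero_right] at ha hw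
  simp only
  have hnear : ∀ y : V, ‖y‖ ≤ ‖w‖ → dist (a + y) x < 2 * δ := fun y hy => by
    rw [dist_eq_norm] at ha ⊢
    calc ‖a + y - x‖ = ‖(a - x) + y‖ := by congr 1; abel
      _ ≤ ‖a - x‖ + ‖y‖ := norm_add_le _ _
      _ < 2 * δ := by linarith
  have hder : ∀ y ∈ closedBall (0 : V) ‖w‖, HasFDerivWithinAt
      (fun y => u (a + y) - u a - fderiv ℝ u a y - 1 / 2 * B y y)
      (fderiv ℝ u (a + y) - fderiv ℝ u a - B y) (closedBall 0 ‖w‖) y := by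
    intro y hy
    rw [mem_closedBall_zero_iff] at hy
    have h2 : HasFDerivAt (fun y => u (a + y)) (fderiv ℝ u (a + y)) y := by
      have := ((hd (a + y) ((hnear y hy).trans_le hδ1)).hasFDerivAt).comp y
        ((hasFDerivAt_id y).const_add a)
      rwa [ContinuousLinearMap.comp_id] at this
    have h3 : HasFDerivAt (fun y => B y y) (B.flip y + B y) y := by
      have := B.hasFDerivAt.clm_apply (hasFDerivAt_id y)
      refine this.congr_fderiv ?_
      ext v
      simp [add_comm]
    have h4 := ((h2.sub_const (u a)).sub (fderiv ℝ u a).hasFDerivAt).sub (h3.const_mul (1 / 2))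
    refine HasFDerivAt.hasFDerivWithinAt (h4.congr_fderiv ?_)
    ext v
    simp [hsymm v y]
    ring
  have hbd : ∀ y ∈ closedBall (0 : V) ‖w‖, ‖fderiv ℝ u (a + y) - fderiv ℝ u a - B y‖ ≤ ε * ‖w‖ := by
    intro y hy
    rw [mem_closedBall_zero_iff] at hy
    have hmem : ((a + y, a) : V × V) ∈ s := by
      refine hball ?_
      rw [mem_ball, Prod.dist_eq, max_lt_iff]
      exact ⟨by linarith [hnear y hy], by linarith⟩
    have := hs' _ hmem
    simp only [add_sub_cancel_left] at this
    exact this.trans (mul_le_mul_of_nonneg_left hy hε.le)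
  have := (convex_closedBall (0 : V) ‖w‖).norm_image_sub_le_of_norm_hasFDerivWithin_le hder hbd
    (by simp : (0 : V) ∈ _) (by simp : w ∈ _)
  simp only [add_zero, sub_self, map_zero, mul_zero, sub_zero] at this
  rw [Real.norm_of_nonneg (by positivity : 0 ≤ ‖w‖ ^ 2), pow_two, ← mul_assoc]
  exact this

section

variable {V : Type*} [NormedAddCommGroup V] [NormedSpace ℝ V] [CompleteSpace V]

/-- The inverses of maps which are `C¹`-close to the identity converge locally uniformly. -/
theorem tendsto_inverse_of_tendsto_id {φ ψ : ℕ → V → V} {x : V}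
    (hψ : ∀ n y, ψ n (φ n y) = y) (hφ : ∀ n, Differentiable ℝ (φ n))
    (h0 : Tendsto (fun p : ℕ × V => φ p.1 p.2 - p.2) (atTop ×ˢ 𝓝 x) (𝓝 0))
    (h1 : Tendsto (fun p : ℕ × V => fderiv ℝ (fun y => φ p.1 y - y) p.2) (atTop ×ˢ 𝓝 x) (𝓝 0)) :
    Tendsto (fun p : ℕ × V => ψ p.1 p.2) (atTop ×ˢ 𝓝 x) (𝓝 x) := by
  have hsmall : ∀ᶠ p : ℕ × V in atTop ×ˢ 𝓝 x, ‖fderiv ℝ (fun y => φ p.1 y - y) p.2‖ < 1 / 2 := by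
    have := h1.norm
    rw [norm_zero] at this
    exact this.eventually (gt_mem_nhds (by norm_num))
  obtain ⟨P, hP, Q, hQ, hPQ⟩ := eventually_prod_iff.1 hsmall
  obtain ⟨r₀, hr₀, hQr⟩ := Metric.eventually_nhds_iff_ball.1 hQ
  refine Metric.tendsto_nhds.2 fun ε hε => ?_
  set r := min ε r₀ / 2
  have hr : 0 < r := by positivity
  have hrε : r < ε := by
    have := min_le_left ε r₀
    simp only [r]; linarith
  have hrr : r < r₀ := by
    have := min_le_right ε r₀
    simp only [r]; linarith
  have h0x : Tendsto (fun n => ‖φ n x - x‖) atTop (𝓝 0) := by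
    have := (h0.comp (tendsto_id.prodMk (tendsto_const_nhds (x := x)))).norm
    simpa using this
  have hev : ∀ᶠ n in atTop, P n ∧ ‖φ n x - x‖ < r / 4 :=
    hP.and (h0x.eventually (gt_mem_nhds (by positivity)))
  filter_upwards [hev.prod_mk (ball_mem_nhds x (by positivity : 0 < r / 4))]
    with ⟨n, y⟩ ⟨⟨hPn, hn⟩, hy⟩
  simp only at hPn hn hy ⊢
  rw [dist_eq_norm] at hy
  have hlip : ∀ a ∈ closedBall x r, ∀ b ∈ closedBall x r,
      ‖(φ n b - b) - (φ n a - a)‖ ≤ 1 / 2 * ‖b - a‖ := fun a ha b hb =>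
    (convex_closedBall x r).norm_image_sub_le_of_norm_fderiv_le (f := fun y => φ n y - y)
      (fun c _ => ((hφ n) c).sub differentiableAt_id)
      (fun c hc => (hPQ hPn (hQr c (closedBall_subset_ball hrr hc))).le) ha hb
  have hmaps : MapsTo (fun w => y - (φ n w - w)) (closedBall x r) (closedBall x r) := by
    intro w hw
    have h2 := hlip x (mem_closedBall_self hr.le) w hw
    rw [mem_closedBall, dist_eq_norm] at hw ⊢
    have h3 : y - (φ n w - w) - x = (y - x) - (((φ n w - w) - (φ n x - x)) + (φ n x - x)) := by abel
    rw [h3]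
    have h4 := norm_sub_le (y - x) (((φ n w - w) - (φ n x - x)) + (φ n x - x))
    have h5 := norm_add_le ((φ n w - w) - (φ n x - x)) (φ n x - x)
    linarith
  have hcontr : ContractingWith (1 / 2) (hmaps.restrict _ _ _) := by
    refine ⟨by rw [← NNReal.coe_lt_coe]; norm_num, LipschitzWith.of_dist_le_mul fun a b => ?_⟩
    rw [Subtype.dist_eq, Subtype.dist_eq, dist_eq_norm, dist_eq_norm, MapsTo.val_restrict_apply,
      MapsTo.val_restrict_apply, sub_sub_sub_cancel_left, norm_sub_rev (a : V)]
    simpa using hlip a a.2 b b.2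
  obtain ⟨w, hw, hfix, -⟩ := hcontr.exists_fixedPoint' isClosed_closedBall.isComplete hmaps
    (mem_closedBall_self hr.le) (edist_ne_top _ _)
  have hwy : φ n w = y := by
    have h2 : y - (φ n w - w) = w := hfix
    rw [sub_eq_iff_eq_add, add_sub_cancel] at h2
    exact h2.symm
  rw [← hwy, hψ]
  exact (mem_closedBall.1 hw).trans_lt hrε

end

end Taylor

section UniformExpansion

section

variable {V : Type*} [NormedAddCommGroup V] [NormedSpace ℝ V]

/-- First order Taylor expansion of maps with small second derivatives, at moving base points. -/
theorem isLittleO_taylor_one {g : ℕ → V → V} {x : V} {xs : ℕ → V} (hg : ∀ n, ContDiff ℝ 2 (g n))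
    (h2 : Tendsto (fun p : ℕ × V => fderiv ℝ (fderiv ℝ (g p.1)) p.2) (atTop ×ˢ 𝓝 x) (𝓝 0))
    (hxs : Tendsto xs atTop (𝓝 x)) :
    (fun p : ℕ × V => g p.1 (xs p.1 + p.2) - g p.1 (xs p.1) - fderiv ℝ (g p.1) (xs p.1) p.2)
      =o[atTop ×ˢ 𝓝 0] fun p => ‖p.2‖ ^ 2 := by
  refine isLittleO_iff.2 fun ε hε => ?_
  have hsmall : ∀ᶠ p : ℕ × V in atTop ×ˢ 𝓝 x, ‖fderiv ℝ (fderiv ℝ (g p.1)) p.2‖ < ε := by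
    have := h2.norm
    rw [norm_zero] at this
    exact this.eventually (gt_mem_nhds hε)
  obtain ⟨P, hP, Q, hQ, hPQ⟩ := eventually_prod_iff.1 hsmall
  obtain ⟨r, hr, hQr⟩ := Metric.eventually_nhds_iff_ball.1 hQ
  have hev := hP.and (hxs.eventually (ball_mem_nhds x (half_pos hr)))
  filter_upwards [hev.prod_mk (ball_mem_nhds (0 : V) (half_pos hr))] with ⟨n, w⟩ ⟨⟨hPn, hn⟩, hw⟩
  simp only [dist_zero_right] at hPn hn hw ⊢
  set a := xs n
  have hnear : ∀ y : V, ‖y‖ ≤ ‖w‖ → a + y ∈ ball x r := fun y hy => by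
    rw [dist_eq_norm] at hn
    rw [mem_ball, dist_eq_norm]
    calc ‖a + y - x‖ = ‖(a - x) + y‖ := by congr 1; abel
      _ ≤ ‖a - x‖ + ‖y‖ := norm_add_le _ _
      _ < r := by linarith
  have hd1 : Differentiable ℝ (g n) := (hg n).differentiable (by norm_num)
  have hd2 : Differentiable ℝ (fderiv ℝ (g n)) :=
    ((hg n).fderiv_right (m := 1) (by norm_num)).differentiable (by norm_num)
  have hbd : ∀ y ∈ closedBall (0 : V) ‖w‖,
      ‖fderiv ℝ (g n) (a + y) - fderiv ℝ (g n) a‖ ≤ ε * ‖w‖ := by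
    intro y hy
    rw [mem_closedBall_zero_iff] at hy
    have := (convex_ball x r).norm_image_sub_le_of_norm_fderiv_le (f := fderiv ℝ (g n))
      (fun c _ => hd2 c) (fun c hc => (hPQ hPn (hQr c hc)).le)
      (by simpa using hnear 0 (by simp)) (hnear y hy)
    rw [add_sub_cancel_left] at this
    exact this.trans (mul_le_mul_of_nonneg_left hy hε.le)
  have hder : ∀ y ∈ closedBall (0 : V) ‖w‖, HasFDerivWithinAt
      (fun y => g n (a + y) - g n a - fderiv ℝ (g n) a y)
      (fderiv ℝ (g n) (a + y) - fderiv ℝ (g n) a) (closedBall 0 ‖w‖) y := by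
    intro y _
    have h2 : HasFDerivAt (fun y => g n (a + y)) (fderiv ℝ (g n) (a + y)) y := by
      have := (hd1 (a + y)).hasFDerivAt.comp y ((hasFDerivAt_id y).const_add a)
      rwa [ContinuousLinearMap.comp_id] at this
    exact ((h2.sub_const _).sub (fderiv ℝ (g n) a).hasFDerivAt).hasFDerivWithinAt
  have := (convex_closedBall (0 : V) ‖w‖).norm_image_sub_le_of_norm_hasFDerivWithin_le hder hbd
    (by simp : (0 : V) ∈ _) (by simp : w ∈ _)
  simp only [add_zero, sub_self, map_zero, sub_zero] at this
  rw [Real.norm_of_nonneg (by positivity : 0 ≤ ‖w‖ ^ 2), pow_two, ← mul_assoc]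
  exact this

theorem norm_le_two_mul_norm_apply {M : V →L[ℝ] V} (hM : ‖M - ContinuousLinearMap.id ℝ V‖ ≤ 1 / 2)
    (z : V) : ‖z‖ ≤ 2 * ‖M z‖ := by
  have h1 : z = M z - (M - ContinuousLinearMap.id ℝ V) z := by simp
  have h2 := (M - ContinuousLinearMap.id ℝ V).le_opNorm z
  have h3 : ‖z‖ ≤ ‖M z‖ + ‖(M - ContinuousLinearMap.id ℝ V) z‖ := by
    conv_lhs => rw [h1]
    exact norm_sub_le _ _
  nlinarith [norm_nonneg z]

theorem norm_apply_le_two_mul_norm {M : V →L[ℝ] V} (hM : ‖M - ContinuousLinearMap.id ℝ V‖ ≤ 1)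
    (z : V) : ‖M z‖ ≤ 2 * ‖z‖ := by
  have h1 : M z = z + (M - ContinuousLinearMap.id ℝ V) z := by simp
  have h2 := (M - ContinuousLinearMap.id ℝ V).le_opNorm z
  rw [h1]
  have h3 := norm_add_le z ((M - ContinuousLinearMap.id ℝ V) z)
  nlinarith [norm_nonneg z]

theorem eventually_norm_sub_id_le {M : ℕ → V →L[ℝ] V}
    (hM : Tendsto M atTop (𝓝 (ContinuousLinearMap.id ℝ V))) {ε : ℝ} (hε : 0 < ε) :
    ∀ᶠ n in atTop, ‖M n - ContinuousLinearMap.id ℝ V‖ ≤ ε := by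
  have := (tendsto_iff_norm_sub_tendsto_zero.1 hM).eventually (gt_mem_nhds hε)
  filter_upwards [this] with n hn using hn.le

end

variable {V : Type*} [NormedAddCommGroup V] [InnerProductSpace ℝ V] [CompleteSpace V]

/-- If `φ n` converges to the identity in `C²`, with inverse `ψ n`, and `u` is of class `C²`, then
`u ∘ ψ n` has, in suitable linear coordinates converging to the identity, a second order expansion
uniform in `n`. -/
theorem exists_uniform_expansion {φ ψ : ℕ → V → V} {x ν : V} {u : V → ℝ}
    (hψ : ∀ n y, ψ n (φ n y) = y) (hψ' : ∀ n y, φ n (ψ n y) = y) (hφ : ∀ n, ContDiff ℝ 2 (φ n))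
    (h0 : Tendsto (fun p : ℕ × V => φ p.1 p.2 - p.2) (atTop ×ˢ 𝓝 x) (𝓝 0))
    (h1 : Tendsto (fun p : ℕ × V => fderiv ℝ (fun y => φ p.1 y - y) p.2) (atTop ×ˢ 𝓝 x) (𝓝 0))
    (h2 : Tendsto (fun p : ℕ × V => fderiv ℝ (fderiv ℝ fun y => φ p.1 y - y) p.2) (atTop ×ˢ 𝓝 x)
      (𝓝 0))
    (hu : ContDiffAt ℝ 2 u x) (hux : fderiv ℝ u x = innerSL ℝ ν) (hν : ‖ν‖ = 1)
    (hzero : ∀ᶠ n in atTop, u (ψ n x) = 0) :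
    ∃ A : ℕ → V →L[ℝ] V, Tendsto A atTop (𝓝 (ContinuousLinearMap.id ℝ V)) ∧
      Tendsto (fun p : ℕ × V => ψ p.1 (x + A p.1 p.2)) (atTop ×ˢ 𝓝 0) (𝓝 x) ∧
      (fun p : ℕ × V => u (ψ p.1 (x + A p.1 p.2)) - ⟪ν, p.2⟫ -
        1 / 2 * fderiv ℝ (fderiv ℝ u) x p.2 p.2) =o[atTop ×ˢ 𝓝 0] fun p => ‖p.2‖ ^ 2 := by
  set I := ContinuousLinearMap.id ℝ V
  have hφd : ∀ n, Differentiable ℝ (φ n) := fun n => (hφ n).differentiable (by norm_num)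
  have hinv := tendsto_inverse_of_tendsto_id hψ hφd h0 h1
  set xs : ℕ → V := fun n => ψ n x with hxs_def
  have hxs : Tendsto xs atTop (𝓝 x) :=
    hinv.comp (tendsto_id.prodMk (tendsto_const_nhds (x := x)))
  set M : ℕ → V →L[ℝ] V := fun n => I + fderiv ℝ (fun y => φ n y - y) (xs n) with hM_def
  have hM : Tendsto M atTop (𝓝 I) := by
    simpa using (h1.comp (tendsto_id.prodMk hxs)).const_add I
  set P : ℕ → V →L[ℝ] ℝ := fun n => fderiv ℝ u (xs n) with hP_def
  have hP : Tendsto P atTop (𝓝 (innerSL ℝ ν)) := by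
    rw [← hux]
    exact ((hu.fderiv_right (m := 1) (by norm_num)).continuousAt).tendsto.comp hxs
  have hPν : Tendsto (fun n => P n ν) atTop (𝓝 1) := by
    have h3 := ((ContinuousLinearMap.apply ℝ ℝ ν).continuous.tendsto _).comp hP
    have h4 : ContinuousLinearMap.apply ℝ ℝ ν (innerSL ℝ ν) = 1 := by
      simp [hν]
    rw [h4] at h3
    exact h3
  set B : ℕ → V →L[ℝ] V := fun n => I + ((P n ν)⁻¹ • (innerSL ℝ ν - P n)).smulRight ν with hB_def
  have hB : Tendsto B atTop (𝓝 I) := by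
    have h3 : Tendsto (fun n => (P n ν)⁻¹ • (innerSL ℝ ν - P n)) atTop (𝓝 0) := by
      simpa using (hPν.inv₀ one_ne_zero).smul (hP.const_sub (innerSL ℝ ν))
    have h4 := ((ContinuousLinearMap.smulRightL ℝ V V).flip ν).continuous.tendsto 0
    have h5 := (h4.comp h3).const_add I
    rw [map_zero, add_zero] at h5
    exact h5
  have hPB : ∀ᶠ n in atTop, ∀ z, P n (B n z) = ⟪ν, z⟫ := by
    filter_upwards [hPν.eventually_ne one_ne_zero] with n hn z
    simp only [hB_def, I, add_apply, ContinuousLinearMap.id_apply,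
      ContinuousLinearMap.smulRight_apply, FunLike.coe_smul, Pi.smul_apply,
      FunLike.coe_sub, Pi.sub_apply, innerSL_apply_apply, map_add, map_smul, smul_eq_mul]
    field_simp
    ring
  have hA : Tendsto (fun n => (M n).comp (B n)) atTop (𝓝 I) := by
    have h3 := (isBoundedBilinearMap_comp (𝕜 := ℝ) (E := V) (F := V) (G := V)).continuous.tendsto
      (I, I)
    exact h3.comp (hM.prodMk_nhds hB)
  set A : ℕ → V →L[ℝ] V := fun n => (M n).comp (B n)
  set L : Filter (ℕ × V) := atTop ×ˢ 𝓝 0 with hL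
  have hL1 : Tendsto (fun p : ℕ × V => p.1) L atTop := tendsto_fst
  have hL2 : Tendsto (fun p : ℕ × V => p.2) L (𝓝 0) := tendsto_snd
  have hAz : Tendsto (fun p : ℕ × V => A p.1 p.2) L (𝓝 0) := by
    have h3 := isBoundedBilinearMap_apply (𝕜 := ℝ) (E := V) (F := V) |>.continuous.tendsto (I, 0)
    have h4 := h3.comp ((hA.comp hL1).prodMk_nhds hL2)
    simpa [Function.comp_def] using h4
  have hψA : Tendsto (fun p : ℕ × V => ψ p.1 (x + A p.1 p.2)) L (𝓝 x) := by
    have h3 : Tendsto (fun p : ℕ × V => x + A p.1 p.2) L (𝓝 x) := by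
      simpa using hAz.const_add x
    exact hinv.comp (hL1.prodMk h3)
  refine ⟨A, hA, hψA, ?_⟩
  set w : ℕ × V → V := fun p => ψ p.1 (x + A p.1 p.2) - xs p.1 with hw_def
  have hw : Tendsto w L (𝓝 0) := by
    simpa using hψA.sub (hxs.comp hL1)
  have hR : (fun p : ℕ × V => A p.1 p.2 - M p.1 (w p)) =o[L] fun p => ‖w p‖ ^ 2 := by
    have hg : ∀ n, ContDiff ℝ 2 fun y => φ n y - y := fun n => (hφ n).sub contDiff_id
    have h3 := (isLittleO_taylor_one hg h2 hxs).comp_tendsto (hL1.prodMk hw)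
    refine h3.congr_left fun p => ?_
    simp only [Function.comp_apply, hM_def, add_apply, I, ContinuousLinearMap.id_apply]
    have h4 : xs p.1 + w p = ψ p.1 (x + A p.1 p.2) := by simp [hw_def]
    rw [h4, hψ', hxs_def]
    simp only [hψ', hw_def, hxs_def]
    abel
  have hMbd : ∀ᶠ p in L, ∀ z, ‖z‖ ≤ 2 * ‖M p.1 z‖ :=
    hL1.eventually ((eventually_norm_sub_id_le hM (by norm_num)).mono
      fun n hn z => norm_le_two_mul_norm_apply hn z)
  have hAbd : ∀ᶠ p in L, ‖A p.1 p.2‖ ≤ 2 * ‖p.2‖ :=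
    hL1.eventually ((eventually_norm_sub_id_le hA one_pos).mono
      fun n hn => norm_apply_le_two_mul_norm hn) |>.mono fun p hp => hp p.2
  have hwz : w =O[L] fun p => p.2 := by
    have h3 : (fun p : ℕ × V => A p.1 p.2 - M p.1 (w p)) =o[L] w := by
      refine hR.trans_isBigO (IsBigO.of_bound 1 ?_)
      filter_upwards [hw.eventually (ball_mem_nhds 0 one_pos)] with p hp
      rw [dist_zero_right] at hp
      rw [norm_pow, norm_norm]
      nlinarith [norm_nonneg (w p)]
    refine IsBigO.of_bound 8 ?_
    filter_upwards [hMbd, hAbd, isLittleO_iff.1 h3 (by norm_num : (0 : ℝ) < 1 / 4)] with p h4 h5 h6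
    have h7 := h4 (w p)
    have h8 : ‖M p.1 (w p)‖ ≤ ‖A p.1 p.2‖ + ‖A p.1 p.2 - M p.1 (w p)‖ := by
      have := norm_sub_le (A p.1 p.2) (A p.1 p.2 - M p.1 (w p))
      rwa [sub_sub_cancel] at this
    linarith
  have hwz2 : (fun p => ‖w p‖ ^ 2) =O[L] fun p : ℕ × V => ‖p.2‖ ^ 2 := hwz.norm_norm.pow 2
  have hwB : (fun p : ℕ × V => w p - B p.1 p.2) =o[L] fun p => ‖p.2‖ ^ 2 := by
    have h3 : (fun p : ℕ × V => w p - B p.1 p.2) =O[L]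
        fun p => A p.1 p.2 - M p.1 (w p) := by
      refine IsBigO.of_bound 2 ?_
      filter_upwards [hMbd] with p h4
      refine (h4 _).trans_eq ?_
      rw [map_sub, norm_sub_rev]
      rfl
    exact h3.trans_isLittleO (hR.trans_isBigO hwz2)
  have hBz : (fun p : ℕ × V => B p.1 p.2 - p.2) =o[L] fun p => p.2 := by
    refine isLittleO_iff.2 fun ε hε => ?_
    filter_upwards [hL1.eventually (eventually_norm_sub_id_le hB hε)] with p hp
    have := ((B p.1 - I).le_opNorm p.2).trans (mul_le_mul_of_nonneg_right hp (norm_nonneg _))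
    simpa [I] using this
  have hsq : (fun p : ℕ × V => ‖p.2‖ ^ 2) =O[L] fun p => p.2 := by
    refine IsBigO.of_bound 1 ?_
    filter_upwards [hL2.eventually (ball_mem_nhds 0 one_pos)] with p hp
    rw [dist_zero_right] at hp
    rw [norm_pow, norm_norm]
    nlinarith [norm_nonneg p.2]
  have hwid : (fun p : ℕ × V => w p - p.2) =o[L] fun p => p.2 := by
    refine ((hwB.trans_isBigO hsq).add hBz).congr_left fun p => ?_
    abel
  set Q := fderiv ℝ (fderiv ℝ u) x
  have hT : (fun p : ℕ × V => u (xs p.1 + w p) - u (xs p.1) - P p.1 (w p) -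
      1 / 2 * Q (w p) (w p)) =o[L] fun p => ‖p.2‖ ^ 2 := by
    have h3 := (isLittleO_taylor_two hu).comp_tendsto ((hxs.comp hL1).prodMk hw)
    exact IsLittleO.trans_isBigO h3 hwz2
  have hPw : (fun p : ℕ × V => P p.1 (w p - B p.1 p.2)) =o[L] fun p => ‖p.2‖ ^ 2 := by
    refine IsBigO.trans_isLittleO (IsBigO.of_bound (‖innerSL ℝ ν‖ + 1) ?_) hwB
    filter_upwards [hL1.eventually (hP.norm.eventually (gt_mem_nhds (lt_add_one _)))] with p hp
    exact ((P p.1).le_opNorm _).trans (mul_le_mul_of_nonneg_right hp.le (norm_nonneg _))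
  have hQ : (fun p : ℕ × V => Q (w p) (w p) - Q p.2 p.2) =o[L] fun p => ‖p.2‖ ^ 2 := by
    have hb : ∀ {a b : ℕ × V → V}, (fun p => Q (a p) (b p)) =O[L] fun p => ‖a p‖ * ‖b p‖ :=
      fun {a b} => IsBigO.of_bound ‖Q‖ (Eventually.of_forall fun p => by
        rw [norm_mul, norm_norm, norm_norm, ← mul_assoc]
        exact Q.le_opNorm₂ _ _)
    have h3 : (fun p : ℕ × V => Q (w p - p.2) (w p)) =o[L] fun p => ‖p.2‖ ^ 2 :=
      hb.trans_isLittleO ((hwid.norm_norm.mul_isBigO hwz.norm_norm).congr_right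
        fun p => (pow_two _).symm)
    have h4 : (fun p : ℕ × V => Q p.2 (w p - p.2)) =o[L] fun p => ‖p.2‖ ^ 2 :=
      hb.trans_isLittleO (((isBigO_refl (fun p : ℕ × V => ‖p.2‖) L).mul_isLittleO
        hwid.norm_norm).congr_right fun p => (pow_two _).symm)
    refine (h3.add h4).congr_left fun p => ?_
    simp only [map_sub, sub_apply]
    ring
  refine ((hT.add hPw).add (hQ.const_mul_left (1 / 2))).congr' ?_ EventuallyEq.rfl
  filter_upwards [hL1.eventually hPB, hL1.eventually hzero] with p h3 h4
  have h5 : xs p.1 + w p = ψ p.1 (x + A p.1 p.2) := by simp [hw_def]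
  have h6 : u (xs p.1) = 0 := h4
  rw [h5, h6, map_sub (P p.1) (w p), h3]
  ring

end UniformExpansion

section DefiningFunction

variable {d : ℕ}

/-- A function whose sublevel set `{y | u y ≤ 0}` is the subgraph of `f` over `p + ν^⊥`. -/
def definingFunction (p ν : EuclideanSpace ℝ (Fin d)) (f : (ℝ ∙ ν)ᗮ → ℝ)
    (y : EuclideanSpace ℝ (Fin d)) : ℝ :=
  ⟪ν, y - p⟫ - f (tangentProj ν (y - p))

section

variable {E : Set (EuclideanSpace ℝ (Fin d))} {p ν : EuclideanSpace ℝ (Fin d)} {f : (ℝ ∙ ν)ᗮ → ℝ}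

theorem IsNormalGraph.eventually_mem_iff_definingFunction (h : IsNormalGraph E p ν f) :
    ∀ᶠ y in 𝓝 p, (y ∈ E ↔ definingFunction p ν f y ≤ 0) := by
  filter_upwards [h.eventually_mem_iff] with y hy
  rw [hy, definingFunction, sub_nonpos]

theorem IsNormalGraph.contDiffAt_definingFunction (h : IsNormalGraph E p ν f) :
    ContDiffAt ℝ 2 (definingFunction p ν f) p := by
  unfold definingFunction
  have h1 : ContDiffAt ℝ 2 (fun y => tangentProj ν (y - p)) p :=
    (tangentProj ν).contDiff.contDiffAt.comp p (contDiffAt_id.sub contDiffAt_const)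
  have h2 : ContDiffAt ℝ 2 (fun y => f (tangentProj ν (y - p))) p := by
    refine ContDiffAt.comp (f := fun y => tangentProj ν (y - p)) (g := f) p ?_ h1
    simpa using h.contDiffAt
  exact (contDiffAt_const.inner ℝ (contDiffAt_id.sub contDiffAt_const)).sub h2

theorem IsNormalGraph.fderiv_definingFunction_eventuallyEq (h : IsNormalGraph E p ν f) :
    fderiv ℝ (definingFunction p ν f) =ᶠ[𝓝 p] fun y =>
      innerSL ℝ ν - (fderiv ℝ f (tangentProj ν (y - p))).comp (tangentProj ν) := by
  have h0 : ∀ᶠ v in 𝓝 (0 : (ℝ ∙ ν)ᗮ), DifferentiableAt ℝ f v := by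
    filter_upwards [h.contDiffAt.eventually (by simp)] with v hv
    exact hv.differentiableAt (by norm_num)
  have hc : Tendsto (fun y => tangentProj ν (y - p)) (𝓝 p) (𝓝 0) := by
    have : Continuous fun y => tangentProj ν (y - p) := by fun_prop
    simpa using this.tendsto p
  filter_upwards [hc.eventually h0] with y hy
  have h1 : HasFDerivAt (fun y => y - p) (ContinuousLinearMap.id ℝ _) y :=
    (hasFDerivAt_id y).sub_const p
  have h2 : HasFDerivAt (fun y => tangentProj ν (y - p)) (tangentProj ν) y := by
    have := (tangentProj ν).hasFDerivAt.comp y h1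
    rwa [ContinuousLinearMap.comp_id] at this
  have h3 : HasFDerivAt (fun y => ⟪ν, y - p⟫) (innerSL ℝ ν) y := by
    have := (innerSL ℝ ν).hasFDerivAt.comp y h1
    rwa [ContinuousLinearMap.comp_id] at this
  exact (h3.sub (hy.hasFDerivAt.comp y h2)).fderiv

theorem IsNormalGraph.fderiv_definingFunction (h : IsNormalGraph E p ν f) :
    fderiv ℝ (definingFunction p ν f) p = innerSL ℝ ν := by
  rw [h.fderiv_definingFunction_eventuallyEq.eq_of_nhds]
  simp [h.fderiv_zero]

theorem IsNormalGraph.fderiv_fderiv_definingFunction (h : IsNormalGraph E p ν f)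
    (v w : EuclideanSpace ℝ (Fin d)) :
    fderiv ℝ (fderiv ℝ (definingFunction p ν f)) p v w =
      - fderiv ℝ (fderiv ℝ f) 0 (tangentProj ν v) (tangentProj ν w) := by
  rw [h.fderiv_definingFunction_eventuallyEq.fderiv_eq]
  have h1 : HasFDerivAt (fun y => tangentProj ν (y - p)) (tangentProj ν) p := by
    have := (tangentProj ν).hasFDerivAt.comp p ((hasFDerivAt_id p).sub_const p)
    rwa [ContinuousLinearMap.comp_id] at this
  have h2 : DifferentiableAt ℝ (fderiv ℝ f) (tangentProj ν (p - p)) := by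
    have h0 : tangentProj ν (p - p) = 0 := by simp
    rw [h0]
    exact (h.contDiffAt.fderiv_right (m := 1) (by norm_num)).differentiableAt (by norm_num)
  have h3 := HasFDerivAt.comp (g := fderiv ℝ f) (f := fun y => tangentProj ν (y - p)) p
    h2.hasFDerivAt h1
  have h4 := (h3.clm_comp (hasFDerivAt_const (tangentProj ν) p)).const_sub (innerSL ℝ ν)
  have h5 := h4.fderiv
  simp only [Function.comp_def] at h5
  rw [h5]
  simp

theorem IsNormalGraph.eventually_definingFunction_eq_zero (h : IsNormalGraph E p ν f) :
    ∀ᶠ y in 𝓝 p, y ∈ frontier E → definingFunction p ν f y = 0 := by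
  have hc : ∀ᶠ y in 𝓝 p, ContinuousAt (definingFunction p ν f) y := by
    filter_upwards [h.contDiffAt_definingFunction.eventually (by simp)] with y hy
    exact hy.continuousAt
  filter_upwards [hc, eventually_eventually_nhds.2 h.eventually_mem_iff_definingFunction]
    with y hcy hy hyE
  by_contra hne
  rcases lt_or_gt_of_ne hne with hlt | hgt
  · have : E ∈ 𝓝 y := by
      filter_upwards [hy, hcy.eventually (gt_mem_nhds hlt)] with z h1 h2 using h1.2 (le_of_lt h2)
    exact hyE.2 (mem_interior_iff_mem_nhds.2 this)
  · have : Eᶜ ∈ 𝓝 y := by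
      filter_upwards [hy, hcy.eventually (lt_mem_nhds hgt)] with z h1 h2 using
        fun h3 => absurd (h1.1 h3) (not_le.2 h2)
    exact (mem_closure_iff_nhds.1 hyE.1 _ this).elim fun z hz => hz.1 hz.2

end

theorem MemC2Class.isClosed {E : Set (EuclideanSpace ℝ (Fin d))} (h : MemC2Class E) :
    IsClosed E := by
  obtain ⟨U, -, rfl⟩ := h.exists_isOpen
  exact isClosed_closure

theorem tendsto_of_tendstoLocallyUniformly {X V : Type*} [TopologicalSpace X]
    [NormedAddCommGroup V] {F : ℕ → X → V} {G : X → V} (h : TendstoLocallyUniformly F G atTop)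
    (x : X) : Tendsto (fun p : ℕ × X => F p.1 p.2 - G p.2) (atTop ×ˢ 𝓝 x) (𝓝 0) := by
  rw [tendsto_zero_iff_norm_tendsto_zero]
  have h1 := tendstoLocallyUniformly_iff_forall_tendsto.1 h x
  refine (Metric.tendsto_nhds.2 fun ε hε => ?_)
  filter_upwards [h1 (Metric.dist_mem_uniformity hε)] with p hp
  simpa [dist_eq_norm, norm_sub_rev] using hp

theorem tendsto_sub_id_of_iteratedFDeriv {V : Type*} [NormedAddCommGroup V] [NormedSpace ℝ V]
    {φ : ℕ → V → V} (hφ : ∀ n, ContDiff ℝ 2 (φ n))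
    (h : ∀ k ≤ 2, TendstoLocallyUniformly (fun n => iteratedFDeriv ℝ k (φ n))
      (iteratedFDeriv ℝ k id) atTop) (x : V) :
    Tendsto (fun p : ℕ × V => φ p.1 p.2 - p.2) (atTop ×ˢ 𝓝 x) (𝓝 0) ∧
    Tendsto (fun p : ℕ × V => fderiv ℝ (fun y => φ p.1 y - y) p.2) (atTop ×ˢ 𝓝 x) (𝓝 0) ∧
    Tendsto (fun p : ℕ × V => fderiv ℝ (fderiv ℝ fun y => φ p.1 y - y) p.2) (atTop ×ˢ 𝓝 x)
      (𝓝 0) := by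
  have key : ∀ k ≤ 2, Tendsto (fun p : ℕ × V => ‖iteratedFDeriv ℝ k (fun y => φ p.1 y - y) p.2‖)
      (atTop ×ˢ 𝓝 x) (𝓝 0) := by
    intro k hk
    have h1 := (tendsto_of_tendstoLocallyUniformly (h k hk) x).norm
    rw [norm_zero] at h1
    refine h1.congr fun p => ?_
    have h2 : iteratedFDeriv ℝ k (fun y => φ p.1 y - y) p.2 =
        iteratedFDeriv ℝ k (φ p.1) p.2 - iteratedFDeriv ℝ k id p.2 := by
      have hk' : (k : WithTop ℕ∞) ≤ 2 := by exact_mod_cast hk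
      exact iteratedFDeriv_sub_apply (((hφ p.1).of_le hk').contDiffAt)
        (contDiff_id.contDiffAt)
    rw [h2]
  refine ⟨?_, ?_, ?_⟩
  · refine tendsto_zero_iff_norm_tendsto_zero.2 ((key 0 (by norm_num)).congr fun p => ?_)
    rw [norm_iteratedFDeriv_zero]
  · refine tendsto_zero_iff_norm_tendsto_zero.2 ((key 1 (by norm_num)).congr fun p => ?_)
    rw [norm_iteratedFDeriv_one]
  · refine tendsto_zero_iff_norm_tendsto_zero.2 ((key 2 le_rfl).congr fun p => ?_)
    rw [← norm_iteratedFDeriv_one, norm_iteratedFDeriv_fderiv]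

section

variable {x ν : EuclideanSpace ℝ (Fin d)}

theorem isParabolic_signDefect {E : Set (EuclideanSpace ℝ (Fin d))} (hE : MeasurableSet E)
    {A : EuclideanSpace ℝ (Fin d) ≃L[ℝ] EuclideanSpace ℝ (Fin d)} {C ρ : ℝ}
    {w : EuclideanSpace ℝ (Fin d) → ℝ}
    (hw : ∀ z, ‖z‖ ≤ ρ → (x + A z ∈ E ↔ w z ≤ 0) ∧ |w z - ⟪ν, z⟫| ≤ C * ‖z‖ ^ 2) :
    IsParabolic ν C ρ (signDefect E x ν A) where
  measurable := by
    have h1 := measurable_halfSpaceSign ν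
    have h2 := measurable_signedIndicator hE
    have h3 : Measurable fun z => x + A z := by fun_prop
    exact (h2.comp h3).sub h1
  abs_le z := by
    have h1 := abs_sub (signedIndicator E (x + A z)) (halfSpaceSign ν z)
    rw [abs_signedIndicator, abs_halfSpaceSign] at h1
    exact h1.trans (by norm_num)
  eq_zero z hz h := by
    obtain ⟨h1, h2⟩ := hw z hz
    obtain ⟨h3, h4⟩ := abs_le.1 h2
    rcases lt_abs.1 h with h5 | h5
    · rw [signDefect, signedIndicator_of_notMem (fun h6 => by linarith [h1.1 h6]), halfSpaceSign,
        if_pos (by nlinarith [abs_nonneg (w z - ⟪ν, z⟫)]), sub_self]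
    · rw [signDefect, signedIndicator_of_mem (h1.2 (by linarith)), halfSpaceSign,
        if_neg (by nlinarith [abs_nonneg (w z - ⟪ν, z⟫)]), sub_self]

theorem exists_isParabolic_signDefect {En : ℕ → Set (EuclideanSpace ℝ (Fin d))}
    (hEn : ∀ n, MeasurableSet (En n))
    {A : ℕ → EuclideanSpace ℝ (Fin d) →L[ℝ] EuclideanSpace ℝ (Fin d)}
    {w : ℕ × EuclideanSpace ℝ (Fin d) → ℝ}
    {Q : EuclideanSpace ℝ (Fin d) →L[ℝ] EuclideanSpace ℝ (Fin d) →L[ℝ] ℝ}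
    (hmem : ∀ᶠ p : ℕ × EuclideanSpace ℝ (Fin d) in atTop ×ˢ 𝓝 0,
      (x + A p.1 p.2 ∈ En p.1 ↔ w p ≤ 0))
    (hw : (fun p : ℕ × EuclideanSpace ℝ (Fin d) => w p - ⟪ν, p.2⟫ - 1 / 2 * Q p.2 p.2)
      =o[atTop ×ˢ 𝓝 0] fun p => ‖p.2‖ ^ 2) :
    ∃ C ρ : ℝ, 0 < ρ ∧ ρ ≤ 1 ∧ 0 ≤ C ∧ C * ρ ≤ 1 / 2 ∧ ∀ᶠ n in atTop,
      ∀ A' : EuclideanSpace ℝ (Fin d) ≃L[ℝ] EuclideanSpace ℝ (Fin d), (∀ z, A' z = A n z) →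
        IsParabolic ν C ρ (signDefect (En n) x ν A') := by
  set C := ‖Q‖ + 1
  have hC : 0 < C := by positivity
  have hev : ∀ᶠ p : ℕ × EuclideanSpace ℝ (Fin d) in atTop ×ˢ 𝓝 0,
      (x + A p.1 p.2 ∈ En p.1 ↔ w p ≤ 0) ∧ |w p - ⟪ν, p.2⟫| ≤ C * ‖p.2‖ ^ 2 := by
    filter_upwards [hmem, isLittleO_iff.1 hw one_pos] with p h1 h2
    refine ⟨h1, ?_⟩
    rw [Real.norm_eq_abs, one_mul, norm_pow, norm_norm] at h2
    have h3 : |Q p.2 p.2| ≤ ‖Q‖ * ‖p.2‖ * ‖p.2‖ := Q.le_opNorm₂ _ _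
    have h4 : w p - ⟪ν, p.2⟫ = (w p - ⟪ν, p.2⟫ - 1 / 2 * Q p.2 p.2) + 1 / 2 * Q p.2 p.2 := by ring
    rw [h4]
    refine (abs_add_le _ _).trans ?_
    rw [abs_mul, abs_of_pos (by norm_num : (0 : ℝ) < 1 / 2)]
    simp only [C]
    nlinarith [norm_nonneg Q, mul_nonneg (norm_nonneg Q) (sq_nonneg ‖p.2‖)]
  obtain ⟨P, hP, R, hR, hPR⟩ := eventually_prod_iff.1 hev
  obtain ⟨r, hr, hRr⟩ := Metric.eventually_nhds_iff_ball.1 hR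
  refine ⟨C, min (r / 2) (min 1 (1 / (2 * C))), by positivity,
    (min_le_right _ _).trans (min_le_left _ _), hC.le, ?_, ?_⟩
  · calc C * min (r / 2) (min 1 (1 / (2 * C))) ≤ C * (1 / (2 * C)) :=
          mul_le_mul_of_nonneg_left ((min_le_right _ _).trans (min_le_right _ _)) hC.le
      _ = 1 / 2 := by field_simp
  · filter_upwards [hP] with n hn A' hA'
    refine isParabolic_signDefect (hEn n) (w := fun z => w (n, z)) fun z hz => ?_
    rw [hA']
    refine hPR hn (hRr z ?_)
    rw [mem_ball_zero_iff]
    linarith [hz.trans (min_le_left _ _)]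

theorem tendsto_signDefect (hν : ‖ν‖ = 1) {En : ℕ → Set (EuclideanSpace ℝ (Fin d))}
    {A : ℕ → EuclideanSpace ℝ (Fin d) →L[ℝ] EuclideanSpace ℝ (Fin d)}
    {w : ℕ × EuclideanSpace ℝ (Fin d) → ℝ}
    {Q : EuclideanSpace ℝ (Fin d) →L[ℝ] EuclideanSpace ℝ (Fin d) →L[ℝ] ℝ}
    (hmem : ∀ᶠ p : ℕ × EuclideanSpace ℝ (Fin d) in atTop ×ˢ 𝓝 0,
      (x + A p.1 p.2 ∈ En p.1 ↔ w p ≤ 0))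
    (hw : (fun p : ℕ × EuclideanSpace ℝ (Fin d) => w p - ⟪ν, p.2⟫ - 1 / 2 * Q p.2 p.2)
      =o[atTop ×ˢ 𝓝 0] fun p => ‖p.2‖ ^ 2)
    {e : EuclideanSpace ℝ (Fin d)} (he : ⟪ν, e⟫ = 0) {η : ℝ} (hη : η ≠ -(1 / 2 * Q e e)) :
    Tendsto (fun p : ℕ × ℝ => signedIndicator (En p.1) (x + A p.1 (p.2 • e + (p.2 ^ 2 * η) • ν)) -
        halfSpaceSign ν (p.2 • e + (p.2 ^ 2 * η) • ν)) (atTop ×ˢ 𝓝[>] 0)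
      (𝓝 ((if -(1 / 2 * Q e e) < η then (1 : ℝ) else -1) - (if 0 < η then 1 else -1))) := by
  set L : Filter (ℕ × ℝ) := atTop ×ˢ 𝓝[>] 0
  set z : ℕ × ℝ → EuclideanSpace ℝ (Fin d) := fun p => p.2 • e + (p.2 ^ 2 * η) • ν
  set y : ℕ × ℝ → EuclideanSpace ℝ (Fin d) := fun p => e + (p.2 * η) • ν
  have hzy : ∀ p, z p = p.2 • y p := fun p => by
    simp only [z, y, smul_add, smul_smul]; congr 2; ring
  have ht : Tendsto (fun p : ℕ × ℝ => p.2) L (𝓝 0) :=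
    tendsto_nhds_of_tendsto_nhdsWithin tendsto_snd
  have htpos : ∀ᶠ p : ℕ × ℝ in L, 0 < p.2 :=
    tendsto_snd.eventually (self_mem_nhdsWithin : Ioi (0 : ℝ) ∈ 𝓝[>] 0)
  have hy : Tendsto y L (𝓝 e) := by
    simpa using ((ht.mul_const η).smul_const ν).const_add e
  have hz : Tendsto z L (𝓝 0) := by
    have := ht.smul hy
    rw [zero_smul] at this
    exact this.congr fun p => (hzy p).symm
  have hz' : Tendsto (fun p : ℕ × ℝ => (p.1, z p)) L (atTop ×ˢ 𝓝 0) := tendsto_fst.prodMk hz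
  have hinner : ∀ p, ⟪ν, z p⟫ = p.2 ^ 2 * η := fun p => by
    simp only [z, inner_add_right, inner_smul_right, he, real_inner_self_eq_norm_sq, hν]
    ring
  have hlim : Tendsto (fun p => w (p.1, z p) / p.2 ^ 2) L (𝓝 (η + 1 / 2 * Q e e)) := by
    have h1 : (fun p : ℕ × ℝ => w (p.1, z p) - ⟪ν, z p⟫ - 1 / 2 * Q (z p) (z p)) =o[L]
        fun p => p.2 ^ 2 := by
      refine (hw.comp_tendsto hz').trans_isBigO ?_
      have h2 : (fun p => ‖y p‖ ^ 2) =O[L] fun _ => (1 : ℝ) := (hy.norm.pow 2).isBigO_one ℝ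
      have h3 := (isBigO_refl (fun p : ℕ × ℝ => p.2 ^ 2) L).mul h2
      refine (h3.congr_left fun p => ?_).congr_right fun p => mul_one _
      simp only [Function.comp_apply]
      rw [hzy, norm_smul, mul_pow, Real.norm_eq_abs, sq_abs]
    have h4 := h1.tendsto_div_nhds_zero
    have h5 : Tendsto (fun p => Q (y p) (y p)) L (𝓝 (Q e e)) := by
      have : Continuous fun v => Q v v := by fun_prop
      exact (this.tendsto e).comp hy
    have h6 := h4.add ((h5.const_mul (1 / 2)).const_add η)
    rw [zero_add] at h6
    refine h6.congr' ?_
    filter_upwards [htpos] with p hp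
    have hp0 : p.2 ^ 2 ≠ 0 := (pow_pos hp 2).ne'
    rw [hinner, hzy]
    simp only [map_smul, smul_apply, smul_eq_mul]
    field_simp
    ring
  have hhalf : ∀ᶠ p in L, halfSpaceSign ν (z p) = if 0 < η then 1 else -1 := by
    filter_upwards [htpos] with p hp
    rw [halfSpaceSign, hinner]
    simp [pow_pos hp 2]
  refine tendsto_const_nhds.congr' ?_
  rcases lt_or_gt_of_ne hη with hlt | hgt
  · have hneg := hlim.eventually (gt_mem_nhds (by linarith : η + 1 / 2 * Q e e < 0))
    filter_upwards [hneg, hhalf, htpos, hz'.eventually hmem] with p h1 h2 h3 h4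
    have h5 : w (p.1, z p) < 0 := by
      rw [div_lt_iff₀ (pow_pos h3 2)] at h1; linarith
    rw [h2, if_neg (not_lt.2 hlt.le), signedIndicator_of_mem (h4.2 h5.le)]
  · have hpos := hlim.eventually (lt_mem_nhds (by linarith : 0 < η + 1 / 2 * Q e e))
    filter_upwards [hpos, hhalf, htpos, hz'.eventually hmem] with p h1 h2 h3 h4
    have h5 : 0 < w (p.1, z p) := by
      rwa [div_pos_iff_of_pos_right (pow_pos h3 2)] at h1
    rw [h2, if_pos hgt, signedIndicator_of_notMem (fun h => absurd (h4.1 h) (not_le.2 h5))]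

end

end DefiningFunction

section Limit

theorem setIntegral_sphere_orthogonal {V : Type*} [NormedAddCommGroup V] [InnerProductSpace ℝ V]
    [FiniteDimensional ℝ V] [MeasurableSpace V] [BorelSpace V] (ν : V) (g : V → ℝ) :
    ∫ e in {e : V | ‖e‖ = 1 ∧ ⟪ν, e⟫ = 0}, g e ∂μHE[finrank ℝ (ℝ ∙ ν)ᗮ - 1] =
      ∫ e : sphere (0 : (ℝ ∙ ν)ᗮ) 1, g ((e : (ℝ ∙ ν)ᗮ) : V)
        ∂(volume : Measure (ℝ ∙ ν)ᗮ).toSphere := by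
  set ι : sphere (0 : (ℝ ∙ ν)ᗮ) 1 → V := fun e => ((e : (ℝ ∙ ν)ᗮ) : V)
  have hι : Isometry ι := isometry_subtype_coe.comp isometry_subtype_coe
  have hemb : MeasurableEmbedding ι := hι.isClosedEmbedding.measurableEmbedding
  have hrange : range ι = {e : V | ‖e‖ = 1 ∧ ⟪ν, e⟫ = 0} := by
    ext e
    constructor
    · rintro ⟨e, rfl⟩
      refine ⟨?_, (Submodule.mem_orthogonal_singleton_iff_inner_right).1 (e : (ℝ ∙ ν)ᗮ).2⟩
      simp only [ι]
      rw [← Submodule.coe_norm]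
      simp
    · rintro ⟨h1, h2⟩
      exact ⟨⟨⟨e, (Submodule.mem_orthogonal_singleton_iff_inner_right).2 h2⟩, by simpa using h1⟩, rfl⟩
  have hmap : (volume : Measure (ℝ ∙ ν)ᗮ).toSphere.map ι =
      (μHE[finrank ℝ (ℝ ∙ ν)ᗮ - 1] : Measure V).restrict {e : V | ‖e‖ = 1 ∧ ⟪ν, e⟫ = 0} := by
    refine Measure.ext fun A hA => ?_
    rw [hemb.map_apply, toSphere_eq_comap_euclideanHausdorffMeasure,
      comap_subtype_coe_apply isClosed_sphere.measurableSet, Measure.restrict_apply hA, ← hrange,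
      ← image_preimage_eq_inter_range,
      ← (isometry_subtype_coe (s := ((ℝ ∙ ν)ᗮ : Set V))).euclideanHausdorffMeasure_image, image_image]
  rw [← hmap, hemb.integral_map]

theorem exists_seq_of_eventually {X : Type*} {P : ℕ → X → Prop}
    (h : ∀ᶠ n in atTop, ∃ a, P n a) : ∃ (k : ℕ) (a : ℕ → X), ∀ n, P (n + k) (a n) := by
  obtain ⟨k, hk⟩ := eventually_atTop.1 h
  choose a ha using fun n => hk (n + k) (Nat.le_add_left k n)
  exact ⟨k, a, ha⟩

theorem eventually_exists_continuousLinearEquiv {V : Type*} [NormedAddCommGroup V]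
    [NormedSpace ℝ V] [CompleteSpace V] {A : ℕ → V →L[ℝ] V}
    (hA : Tendsto A atTop (𝓝 (ContinuousLinearMap.id ℝ V))) :
    ∀ᶠ n in atTop, ∃ A' : V ≃L[ℝ] V, (A' : V →L[ℝ] V) = A n :=
  hA.eventually (ContinuousLinearEquiv.nhds (ContinuousLinearEquiv.refl ℝ V))

variable {d : ℕ}

theorem isNormLike_gauge_comp {K : ConvexBody (EuclideanSpace ℝ (Fin d))}
    (hK : (K : Set (EuclideanSpace ℝ (Fin d))) ∈ 𝓝 0) {c : ℝ} (hc : 0 < c)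
    (hcK : ∀ z, c * ‖z‖ ≤ gauge (K : Set (EuclideanSpace ℝ (Fin d))) z)
    {A : EuclideanSpace ℝ (Fin d) →L[ℝ] EuclideanSpace ℝ (Fin d)}
    (hA : ∀ z, ‖z‖ ≤ 2 * ‖A z‖) :
    IsNormLike (c / 2) fun z => gauge (K : Set (EuclideanSpace ℝ (Fin d))) (A z) where
  measurable := ((continuous_gauge K.convex hK).comp A.continuous).measurable
  pos := by positivity
  le z := le_trans (by nlinarith [hA z]) (hcK (A z))
  smul t ht z := by rw [map_smul, gauge_smul_of_nonneg ht.le, smul_eq_mul]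

theorem nontrivial_orthogonal (hd : 2 ≤ d) {ν : EuclideanSpace ℝ (Fin d)} (hν : ‖ν‖ = 1) :
    Nontrivial (ℝ ∙ ν)ᗮ := by
  refine Module.nontrivial_of_finrank_pos (R := ℝ) ?_
  rw [finrank_orthogonal_unit ν hν, finrank_euclideanSpace_fin]
  omega

theorem exists_tendsto_truncatedCurvature (hd : 2 ≤ d)
    {K : ConvexBody (EuclideanSpace ℝ (Fin d))}
    (hK : (K : Set (EuclideanSpace ℝ (Fin d))) ∈ 𝓝 0) (hK_symm : ∀ y ∈ K, -y ∈ K) {α : ℝ}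
    (hα : α ∈ Ioo (0 : ℝ) 1) {E : Set (EuclideanSpace ℝ (Fin d))} (hE : MemC2Class E)
    {x : EuclideanSpace ℝ (Fin d)} (hx : x ∈ frontier E) :
    ∃ l, Tendsto (truncatedCurvature K α x E) (𝓝[>] 0) (𝓝 l) := by
  obtain ⟨ν, f, h⟩ := hE.exists_isNormalGraph x hx
  have := nontrivial_orthogonal hd h.norm_normal
  obtain ⟨c, hc, hcK⟩ := exists_mul_norm_le_gauge hK
  set u := definingFunction x ν f
  have hu : ContDiffAt ℝ 2 u x := h.contDiffAt_definingFunction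
  have hux : u x = 0 := h.eventually_definingFunction_eq_zero.self_of_nhds hx
  have hz : Tendsto (fun p : ℕ × EuclideanSpace ℝ (Fin d) => x + p.2) (atTop ×ˢ 𝓝 0) (𝓝 x) := by
    have : Tendsto (fun p : ℕ × EuclideanSpace ℝ (Fin d) => p.2) (atTop ×ˢ 𝓝 0) (𝓝 0) :=
      tendsto_snd
    simpa using this.const_add x
  have hmem := hz.eventually h.eventually_mem_iff_definingFunction
  have hexp : (fun p : ℕ × EuclideanSpace ℝ (Fin d) => u (x + p.2) - ⟪ν, p.2⟫ -
      1 / 2 * fderiv ℝ (fderiv ℝ u) x p.2 p.2) =o[atTop ×ˢ 𝓝 0] fun p => ‖p.2‖ ^ 2 := by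
    have h1 : Tendsto (fun p : ℕ × EuclideanSpace ℝ (Fin d) => (x, p.2)) (atTop ×ˢ 𝓝 0)
        (𝓝 x ×ˢ 𝓝 0) := tendsto_const_nhds.prodMk tendsto_snd
    refine ((isLittleO_taylor_two hu).comp_tendsto h1).congr_left fun p => ?_
    have h2 : fderiv ℝ u x = innerSL ℝ ν := h.fderiv_definingFunction
    simp [hux, h2]
  obtain ⟨C, ρ, hρ, hρ1, hC, hCρ, hev⟩ := exists_isParabolic_signDefect
    (En := fun _ => E) (A := fun _ => ContinuousLinearMap.id ℝ _)
    (fun _ => hE.isClosed.measurableSet) hmem hexp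
  obtain ⟨n, hn⟩ := hev.exists
  have hN := isNormLike_gauge_comp hK hc hcK
    (A := ContinuousLinearMap.id ℝ (EuclideanSpace ℝ (Fin d)))
    (fun z => by simp only [ContinuousLinearMap.id_apply]; linarith [norm_nonneg z])
  exact ⟨_, tendsto_truncatedCurvature hK_symm (A := ContinuousLinearEquiv.refl ℝ _) hN hρ hρ1 hC
    hCρ hα.1 hα.2 h.norm_normal (hn _ fun z => rfl)⟩

theorem tendsto_mul_anisotropicCurvature (hd : 2 ≤ d)
    {K : ConvexBody (EuclideanSpace ℝ (Fin d))}
    (hK : (K : Set (EuclideanSpace ℝ (Fin d))) ∈ 𝓝 0) (hK_symm : ∀ y ∈ K, -y ∈ K)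
    {α : ℕ → ℝ} (hα_mem : ∀ n, α n ∈ Ioo (0 : ℝ) 1) (hα : Tendsto α atTop (𝓝 1))
    {E : Set (EuclideanSpace ℝ (Fin d))} {En : ℕ → Set (EuclideanSpace ℝ (Fin d))}
    (hEn : ∀ n, MemC2Class (En n)) (hconv : ConvergesInC2 En E)
    {x ν : EuclideanSpace ℝ (Fin d)} {f : (ℝ ∙ ν)ᗮ → ℝ} (h : IsNormalGraph E x ν f)
    (hxn : ∀ n, x ∈ frontier (En n)) :
    Tendsto (fun n => (1 - α n) * anisotropicCurvature K (α n) x (En n)) atTop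
      (𝓝 (1 / kappa d * ∫ e in tangentSphere E x,
        directionalCurvature E x e / gauge (K : Set (EuclideanSpace ℝ (Fin d))) e ^ (d + 1)
          ∂μHE[d - 2])) := by
  have hν := h.norm_normal
  have := nontrivial_orthogonal hd hν
  obtain ⟨c, hc, hcK⟩ := exists_mul_norm_le_gauge hK
  obtain ⟨Φ, hΦE, hΦ⟩ := hconv
  set u := definingFunction x ν f
  have hu : ContDiffAt ℝ 2 u x := h.contDiffAt_definingFunction
  obtain ⟨h0, h1, h2⟩ := tendsto_sub_id_of_iteratedFDeriv (fun n => (Φ n).contDiff) hΦ x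
  have hinv := tendsto_inverse_of_tendsto_id (ψ := fun n => (Φ n).symm)
    (fun n y => (Φ n).symm_apply_apply y) (fun n => (Φ n).contDiff.differentiable (by norm_num)) h0 h1
  have hzero : ∀ᶠ n in atTop, u ((Φ n).symm x) = 0 := by
    have h3 := hinv.comp (tendsto_id.prodMk (tendsto_const_nhds (x := x)))
    filter_upwards [h3.eventually h.eventually_definingFunction_eq_zero] with n hn
    refine hn ?_
    have h4 := hxn n
    rw [hΦE n, ← (Φ n).coe_toHomeomorph, ← (Φ n).toHomeomorph.image_frontier] at h4
    obtain ⟨y, hy, hyx⟩ := h4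
    have h5 : (Φ n).symm x = y := by
      rw [← hyx, (Φ n).coe_toHomeomorph, (Φ n).symm_apply_apply]
    simpa [h5] using hy
  obtain ⟨A, hA, hψA, hexp⟩ := exists_uniform_expansion (φ := fun n => Φ n)
    (ψ := fun n => (Φ n).symm) (fun n y => (Φ n).symm_apply_apply y)
    (fun n y => (Φ n).apply_symm_apply y) (fun n => (Φ n).contDiff) h0 h1 h2 hu
    h.fderiv_definingFunction hν hzero
  have hmem : ∀ᶠ p : ℕ × EuclideanSpace ℝ (Fin d) in atTop ×ˢ 𝓝 0,
      (x + A p.1 p.2 ∈ En p.1 ↔ u ((Φ p.1).symm (x + A p.1 p.2)) ≤ 0) := by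
    filter_upwards [hψA.eventually h.eventually_mem_iff_definingFunction] with p hp
    rw [hΦE p.1, (Φ p.1).image_eq_preimage_symm]
    exact hp
  have hEm : ∀ n, MeasurableSet (En n) := fun n => (hEn n).isClosed.measurableSet
  obtain ⟨C, ρ, hρ, hρ1, hC, hCρ, hpar⟩ := exists_isParabolic_signDefect hEm hmem hexp
  have hgood : ∀ᶠ n in atTop, ∃ A' : EuclideanSpace ℝ (Fin d) ≃L[ℝ] EuclideanSpace ℝ (Fin d),
      ((A' : EuclideanSpace ℝ (Fin d) →L[ℝ] EuclideanSpace ℝ (Fin d)) = A n) ∧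
      IsParabolic ν C ρ (signDefect (En n) x ν A') ∧
      IsNormLike (c / 2) fun z => gauge (K : Set (EuclideanSpace ℝ (Fin d))) (A' z) := by
    filter_upwards [eventually_exists_continuousLinearEquiv hA, hpar,
      eventually_norm_sub_id_le hA (by norm_num : (0 : ℝ) < 1 / 2)] with n ⟨A', hA'⟩ h3 h4
    have h5 : ∀ z, A' z = A n z := fun z => by rw [← hA']; rfl
    refine ⟨A', hA', h3 A' h5, ?_⟩
    simp_rw [h5]
    exact isNormLike_gauge_comp hK hc hcK (norm_le_two_mul_norm_apply h4)
  obtain ⟨k, A', hA'⟩ := exists_seq_of_eventually hgood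
  have hcoe : ∀ n z, A' n z = A (n + k) z := fun n z => by rw [← (hA' n).1]; rfl
  have hshift : Tendsto (fun n : ℕ => n + k) atTop atTop := tendsto_add_atTop_nat k
  set q : (ℝ ∙ ν)ᗮ → ℝ := fun v => 1 / 2 * fderiv ℝ (fderiv ℝ f) 0 v v
  have hq : Measurable q := by
    have : Continuous q := by fun_prop
    exact this.measurable
  have hQ : ∀ e : (ℝ ∙ ν)ᗮ, -(1 / 2 * fderiv ℝ (fderiv ℝ u) x e e) = q e := fun e => by
    have h3 := h.fderiv_fderiv_definingFunction (e : EuclideanSpace ℝ (Fin d)) e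
    have h4 : tangentProj ν (e : EuclideanSpace ℝ (Fin d)) = e := by
      simpa using tangentProj_add_smul e 0
    rw [h4] at h3
    simp only [u, h3, q]
    ring
  have hmain := tendsto_integral_of_isParabolic ν hν hρ hρ1 hC hCρ
    (α := fun n => α (n + k)) (fun n => hα_mem _) (hα.comp hshift)
    (N := fun n z => gauge (K : Set (EuclideanSpace ℝ (Fin d))) (A' n z))
    (D := fun n => signDefect (En (n + k)) x ν (A' n))
    (N' := gauge (K : Set (EuclideanSpace ℝ (Fin d))))
    (fun n => (hA' n).2.2) (fun n => (hA' n).2.1) hq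
    (fun w => by
      have h3 := (continuous_gauge K.convex hK).tendsto w
      refine h3.comp ?_
      have h4 : Tendsto (fun p : ℕ × EuclideanSpace ℝ (Fin d) => A (p.1 + k)) (atTop ×ˢ 𝓝 w)
        (𝓝 (ContinuousLinearMap.id ℝ _)) := hA.comp (hshift.comp tendsto_fst)
      have h5 := (isBoundedBilinearMap_apply (𝕜 := ℝ) (E := EuclideanSpace ℝ (Fin d))
        (F := EuclideanSpace ℝ (Fin d))).continuous.tendsto (ContinuousLinearMap.id ℝ _, w)
      have h6 := h5.comp (h4.prodMk_nhds (tendsto_snd (f := atTop) (g := 𝓝 w)))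
      simp only [ContinuousLinearMap.id_apply] at h6
      exact h6.congr fun p => (hcoe _ _).symm)
    (fun e η hη => by
      rw [← hQ] at hη ⊢
      have h3 := (tendsto_signDefect hν hmem hexp
        ((Submodule.mem_orthogonal_singleton_iff_inner_right).1 (e : (ℝ ∙ ν)ᗮ).2) hη).comp
        ((hshift.comp tendsto_fst).prodMk (tendsto_snd (f := atTop) (g := 𝓝[>] (0 : ℝ))))
      refine h3.congr fun p => ?_
      simp only [Function.comp_apply, signDefect, hcoe])
  have hdet : Tendsto (fun n => |LinearMap.det (((A' n : EuclideanSpace ℝ (Fin d) →L[ℝ]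
      EuclideanSpace ℝ (Fin d))) : EuclideanSpace ℝ (Fin d) →ₗ[ℝ] EuclideanSpace ℝ (Fin d))|)
      atTop (𝓝 1) := by
    have h3 := (ContinuousLinearMap.continuous_det (𝕜 := ℝ)
      (E := EuclideanSpace ℝ (Fin d))).abs.tendsto (ContinuousLinearMap.id ℝ _)
    have h4 := h3.comp (hA.comp hshift)
    have h5 : |(ContinuousLinearMap.id ℝ (EuclideanSpace ℝ (Fin d))).det| = 1 := by
      simp [ContinuousLinearMap.det]
    rw [h5] at h4
    refine h4.congr fun n => ?_
    simp only [Function.comp_apply]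
    rw [← (hA' n).1]
  have hlimits : ∀ n, anisotropicCurvature K (α (n + k)) x (En (n + k)) = _ := fun n =>
    (tendsto_truncatedCurvature hK_symm (hA' n).2.2 hρ hρ1 hC hCρ (hα_mem (n + k)).1
      (hα_mem (n + k)).2 hν (hA' n).2.1).limUnder_eq
  rw [← tendsto_add_atTop_iff_nat k]
  have hfin := (hdet.mul hmain).const_mul (1 / kappa d)
  rw [one_mul] at hfin
  have hrhs : ∫ e in tangentSphere E x,
      directionalCurvature E x e / gauge (K : Set (EuclideanSpace ℝ (Fin d))) e ^ (d + 1)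
        ∂μHE[d - 2] = ∫ e : sphere (0 : (ℝ ∙ ν)ᗮ) 1, -2 * q e /
      gauge (K : Set (EuclideanSpace ℝ (Fin d))) ((e : (ℝ ∙ ν)ᗮ) : EuclideanSpace ℝ (Fin d)) ^
        ((finrank ℝ (EuclideanSpace ℝ (Fin d)) : ℝ) + 1)
        ∂(volume : Measure (ℝ ∙ ν)ᗮ).toSphere := by
    have h3 : d - 2 = finrank ℝ (ℝ ∙ ν)ᗮ - 1 := by
      rw [finrank_orthogonal_unit ν hν, finrank_euclideanSpace_fin]
      omega
    rw [tangentSphere, h.outerNormal_eq, h3, setIntegral_sphere_orthogonal]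
    refine integral_congr_ae (Eventually.of_forall fun e => ?_)
    have h4 : tangentProj ν ((e : (ℝ ∙ ν)ᗮ) : EuclideanSpace ℝ (Fin d)) = e := by
      simpa using tangentProj_add_smul (e : (ℝ ∙ ν)ᗮ) 0
    simp only
    rw [h.directionalCurvature_eq, h4, finrank_euclideanSpace_fin]
    congr 1
    · simp only [q]; ring
    · exact_mod_cast (Real.rpow_natCast _ (d + 1)).symm
  rw [hrhs]
  refine hfin.congr fun n => ?_
  rw [hlimits n, finrank_euclideanSpace_fin]
  ring

end Limit

end AnisotropicCurvature
end

theorem theorem4p10 (d : ℕ) (hd : 2 ≤ d)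
    (K : ConvexBody (EuclideanSpace ℝ (Fin d)))
    (hK_interior : (interior (K : Set (EuclideanSpace ℝ (Fin d)))).Nonempty)
    (hK_symm : ∀ y ∈ K, -y ∈ K)
    (α : ℕ → ℝ) (hα_mem : ∀ n, α n ∈ Ioo (0 : ℝ) 1) (hα : Tendsto α atTop (𝓝 1))
    (E : Set (EuclideanSpace ℝ (Fin d))) (En : ℕ → Set (EuclideanSpace ℝ (Fin d)))
    (hE : MemC2Class E) (hEn : ∀ n, MemC2Class (En n)) (hconv : ConvergesInC2 En E)
    (x : EuclideanSpace ℝ (Fin d)) (hx : x ∈ frontier E) (hxn : ∀ n, x ∈ frontier (En n)) :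
    (∀ n, (∀ r > 0, IntegrableOn (curvatureIntegrand K (α n) x (En n)) (Metric.ball x r)ᶜ) ∧
      Tendsto (truncatedCurvature K (α n) x (En n)) (𝓝[>] 0)
        (𝓝 (anisotropicCurvature K (α n) x (En n)))) ∧
    Tendsto (fun n => (1 - α n) * anisotropicCurvature K (α n) x (En n)) atTop
      (𝓝 (1 / kappa d * ∫ e in tangentSphere E x,
        directionalCurvature E x e / gauge (K : Set (EuclideanSpace ℝ (Fin d))) e ^ (d + 1)
          ∂μHE[d - 2])) := by
  have hK := convexBody_mem_nhds_zero hK_interior hK_symm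
  obtain ⟨c, hc, hcK⟩ := exists_mul_norm_le_gauge hK
  have hN : IsNormLike (c / 2) (gauge (K : Set (EuclideanSpace ℝ (Fin d)))) :=
    isNormLike_gauge_comp hK hc hcK
      (A := ContinuousLinearMap.id ℝ (EuclideanSpace ℝ (Fin d)))
      (fun z => by simp only [ContinuousLinearMap.id_apply]; linarith [norm_nonneg z])
  refine ⟨fun n => ⟨fun r hr => ?_, ?_⟩, ?_⟩
  · exact integrableOn_curvatureIntegrand hN hK_symm (hα_mem n).1 (hα_mem n).2.le
      (hEn n).isClosed.measurableSet x hr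
  · exact tendsto_nhds_limUnder
      (exists_tendsto_truncatedCurvature hd hK hK_symm (hα_mem n) (hEn n) (hxn n))
  · obtain ⟨ν, f, h⟩ := hE.exists_isNormalGraph x hx
    exact tendsto_mul_anisotropicCurvature hd hK hK_symm hα_mem hα hEn hconv h hxn
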